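/- Let $s,t\ge 2$ be coprime integers. A partition is an infinite weakly decreasing sequence $\lambda=(\lambda_1,\lambda_2,\dots)$ of non-negative integers with finite sum $|\lambda|$; its beta-sets are $\mathcal B^\lambda_r=\{\lambda_k-k+r : k\ge 1\}$ for $r\in\mathbb Z$, and we write $\mathcal B^\lambda=\mathcal B^\lambda_0$. Every set of integers which is bounded above and whose complement in $\mathbb Z$ is bounded below is $\mathcal B^\lambda_r$ for a unique pair $(\lambda,r)$. An $s$-core is a partition with no rim $s$-hook (a set of $s$ consecutive cells of the rim of the Young diagram whose removal leaves the Young diagram of a partition); $\mathcal C_s$ denotes the set of $s$-cores, and an $(s,t)$-core is an element of $\mathcal C_s\cap\mathcal C_t$. For $j=i+s\mathbb Z$, let $\lambda^{(j)}$ be the partition having $\{b\in\mathbb Z : i+sb\in\mathcal B^\lambda\}$ as one of its beta-sets (it does not depend on the choice of $i$); these partitions are the components of the $s$-quotient of $\lambda$. Let $W_s$ be the Coxeter group of type $\tilde A_{s-1}$, with generators $w_i$ $(i\in\mathbb Z/s\mathbb Z)$ and relations $w_i^2=1$, $w_iw_j=w_jw_i$ if $j\ne i\pm1$, and $w_iw_jw_i=w_jw_iw_j$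 if $j=i+1\ne i-1$. For a positive integer $u$ coprime to $s$, the level $u$ action of $W_s$ on $\mathbb Z$ is given by $$w_in=\begin{cases}n+u & \text{if } n\equiv (i-1)u-\tfrac12(s-1)(u-1) \pmod s,\\ n-u & \text{if } n\equiv iu-\tfrac12(s-1)(u-1)\pmod s,\\ n&\text{otherwise,}\end{cases}$$ and the level $u$ action of $W_s$ on partitions is given by $\mathcal B^{w\lambda}=w\mathcal B^\lambda$. The level $t$ action of $W_s$ and the level $s$ action of $W_t$ on partitions commute, and so give an action of $W_s\times W_t$. Let $\kappa_{s,t}$ be the partition one of whose beta-sets is the set of integers that are not of the form $as+bt$ with integers $a,b\ge0$. It is the unique largest $(s,t)$-core: it is an $(s,t)$-core, and $|\mu|<|\kappa_{s,t}|$ for every other $(s,t)$-core $\mu$. Let $\mathcal C_{s:t}^{\kappa}$ be the $W_s\times W_t$-orbit containing $\kappa_{s,t}$. Then: 1. The map $\lambda\mapsto(\lambda^{(t\mathbb Z)},\lambda^{(s\mathbb Z)})$ is a bijection $\mathcal C_{s:t}^{\kappa}\to\mathcal C_s\times\mathcal C_t$. 2. For $\lambda\in\mathcal C_{s:t}^{\kappa}$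 and $w\in W_s$ we have $(w\lambda)^{(t\mathbb Z)}=w(\lambda^{(t\mathbb Z)})$, where $w$ acts at level $t$ on $\lambda$ and at level $1$ on $\lambda^{(t\mathbb Z)}$. Symmetrically, for $x\in W_t$ we have $(x\lambda)^{(s\mathbb Z)}=x(\lambda^{(s\mathbb Z)})$, where $x$ acts at level $s$ on $\lambda$ and at level $1$ on $\lambda^{(s\mathbb Z)}$. 3. The bijection is an isomorphism of $W_s\times W_t$-sets, with $W_s$ and $W_t$ acting at level $1$ on $\mathcal C_s$ and $\mathcal C_t$: for $\lambda\in\mathcal C_{s:t}^{\kappa}$, $w\in W_s$ and $x\in W_t$, the partition $(w,x)\lambda$ is sent to $\bigl(w(\lambda^{(t\mathbb Z)}),x(\lambda^{(s\mathbb Z)})\bigr)$. -/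

import Mathlib

/-! Partitions are Mathlib's Young diagrams: the partition `(lam_1, lam_2, ...)` has
`lam_(k+1) = lam.rowLen k` and size `lam.card`; cells are pairs `(row, column)`, both counted
from `0`. -/

namespace KappaOrbit

open Set

/-! ### Rim hooks and cores -/

/-- The rim of a partition: the cells `(i, j)` for which `(i + 1, j + 1)` is not a cell. -/
def rim (lam : YoungDiagram) : Set (ℕ × ℕ) :=
  {x | x ∈ lam ∧ (x.1 + 1, x.2 + 1) ∉ lam}

/-- The content `j - i` of a cell. The rim has exactly one cell on each diagonal that it meets,
and one walks along it from one end to the other by increasing the content by one each time. -/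
def content (x : ℕ × ℕ) : ℤ := (x.2 : ℤ) - (x.1 : ℤ)

/-- `H` is a rim `s`-hook of `lam`: a set of `s` consecutive cells of the rim, whose removal leaves
the Young diagram of a partition. -/
structure IsRimHook (s : ℕ) (lam : YoungDiagram) (H : Finset (ℕ × ℕ)) : Prop where
  subset_rim : ∀ x ∈ H, x ∈ rim lam
  card_eq : H.card = s
  consecutive : ∀ x ∈ H, ∀ z ∈ H, ∀ y ∈ rim lam,
    content x ≤ content y → content y ≤ content z → y ∈ H
  removable : ∃ mu : YoungDiagram, mu.cells = lam.cells \ H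

/-- The set of `s`-cores: the partitions without rim `s`-hooks. -/
def cores (s : ℕ) : Set YoungDiagram :=
  {lam | ¬ ∃ H, IsRimHook s lam H}

/-! ### Beta-sets -/

/-- The beta-set `{lam_k - k + r : k = 1, 2, ...}`. -/
def beta (r : ℤ) (lam : YoungDiagram) : Set ℤ :=
  Set.range fun k : ℕ => (lam.rowLen k : ℤ) - ((k : ℤ) + 1) + r

/-- The partition `lam` such that `B` is the beta-set of `lam` for some integer `r`. It exists and
is unique when `B` is bounded above and its complement is bounded below: see
`exists_beta_ofBeta` and `ofBeta_beta`. -/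
noncomputable def ofBeta (B : Set ℤ) : YoungDiagram :=
  Classical.epsilon fun lam => ∃ r : ℤ, beta r lam = B

theorem beta_strictMono (r : ℤ) (lam : YoungDiagram) :
    StrictMono fun k : ℕ =>
      OrderDual.toDual ((lam.rowLen k : ℤ) - ((k : ℤ) + 1) + r) := by
  intro a b hab
  have h := lam.rowLen_anti a b hab.le
  show (lam.rowLen b : ℤ) - ((b : ℤ) + 1) + r < (lam.rowLen a : ℤ) - ((a : ℤ) + 1) + r
  omega

theorem rowLen_eventually_zero (lam : YoungDiagram) :
    ∃ N, ∀ k, N ≤ k → lam.rowLen k = 0 := by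
  refine ⟨lam.colLen 0, fun k hk => ?_⟩
  by_contra h
  have : (k, 0) ∈ lam := lam.mem_iff_lt_rowLen.2 (Nat.pos_of_ne_zero h)
  have := lam.mem_iff_lt_colLen.1 this
  omega

theorem ext_rowLen {lam mu : YoungDiagram} (h : ∀ k, lam.rowLen k = mu.rowLen k) : lam = mu := by
  apply YoungDiagram.ext
  ext ⟨i, j⟩
  rw [YoungDiagram.mem_cells, YoungDiagram.mem_cells, YoungDiagram.mem_iff_lt_rowLen,
    YoungDiagram.mem_iff_lt_rowLen, h]

theorem beta_inj {r r' : ℤ} {lam mu : YoungDiagram} (h : beta r lam = beta r' mu) :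
    r = r' ∧ lam = mu := by
  have h1 := ((beta_strictMono r lam).range_inj (beta_strictMono r' mu)).1 (by
    have := congrArg (fun S : Set ℤ => OrderDual.toDual '' S) h
    simpa only [beta, ← Set.range_comp, Function.comp_def] using this)
  have h2 : ∀ k : ℕ, (lam.rowLen k : ℤ) - ((k : ℤ) + 1) + r
      = (mu.rowLen k : ℤ) - ((k : ℤ) + 1) + r' := fun k => OrderDual.toDual_inj.1 (congrFun h1 k)
  obtain ⟨N, hN⟩ := rowLen_eventually_zero lam
  obtain ⟨N', hN'⟩ := rowLen_eventually_zero mu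
  have h3 := h2 (max N N')
  rw [hN _ (le_max_left _ _), hN' _ (le_max_right _ _)] at h3
  have hr : r = r' := by omega
  refine ⟨hr, ext_rowLen fun k => ?_⟩
  have := h2 k
  omega

theorem exists_rowLen (f : ℕ → ℕ) (hf : Antitone f) (N : ℕ) (hN : ∀ k, N ≤ k → f k = 0) :
    ∃ lam : YoungDiagram, ∀ k, lam.rowLen k = f k := by
  let lam : YoungDiagram :=
    { cells := (Finset.range N ×ˢ Finset.range (f 0)).filter fun x => x.2 < f x.1
      isLowerSet := by
        rintro ⟨i, j⟩ ⟨i', j'⟩ ⟨h1, h2⟩ h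
        simp only [Finset.coe_filter, Finset.mem_product, Finset.mem_range, mem_ofPred_eq] at h ⊢
        simp only at h1 h2
        have := hf h1
        omega }
  have hmem : ∀ i j, (i, j) ∈ lam ↔ j < f i := by
    intro i j
    rw [← YoungDiagram.mem_cells]
    simp only [lam, Finset.mem_filter, Finset.mem_product, Finset.mem_range]
    refine ⟨fun h => h.2, fun h => ⟨⟨?_, lt_of_lt_of_le h (hf (Nat.zero_le i))⟩, h⟩⟩
    by_contra hc
    have := hN i (by omega)
    omega
  refine ⟨lam, fun k => eq_of_forall_lt_iff fun j => ?_⟩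
  rw [← YoungDiagram.mem_iff_lt_rowLen, hmem]

theorem exists_eq_beta {B : Set ℤ} (h1 : BddAbove B) (h2 : BddBelow Bᶜ) :
    ∃ (r : ℤ) (lam : YoungDiagram), beta r lam = B := by
  classical
  obtain ⟨M, hM⟩ := h1
  obtain ⟨m, hm⟩ := h2
  let p : ℕ → Prop := fun k => M - (k : ℤ) ∈ B
  let K : ℕ := (M - m + 1).toNat
  have hK : ∀ k, K ≤ k → p k := by
    intro k hk
    by_contra hc
    have : m ≤ M - (k : ℤ) := hm hc
    omega
  have hinf : (Set.ofPred p).Infinite :=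
    Set.infinite_of_not_bddAbove fun ⟨b, hb⟩ => by
      have := hb (hK (max K (b + 1)) (le_max_left _ _))
      have := le_max_right K (b + 1)
      omega
  let q : ℕ → Prop := fun k => ¬ p k
  let D : ℕ := Nat.count q K
  have hmono : StrictMono (Nat.nth p) := Nat.nth_strictMono hinf
  have hle : ∀ n, Nat.count q n ≤ D := by
    intro n
    rcases le_total n K with h | h
    · exact Nat.count_monotone q h
    · obtain ⟨d, rfl⟩ := Nat.exists_eq_add_of_le h
      rw [Nat.count_add]
      have : Nat.count (fun k => q (K + k)) d = 0 := by
        rw [Nat.count_eq_card_filter_range, Finset.card_eq_zero, Finset.filter_eq_empty_iff]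
        intro x _ hx
        exact hx (hK _ (Nat.le_add_right _ _))
      omega
  have hsum : ∀ n, Nat.count p n + Nat.count q n = n := by
    intro n
    rw [Nat.count_eq_card_filter_range, Nat.count_eq_card_filter_range,
      Finset.card_filter_add_card_filter_not, Finset.card_range]
  have hcq : ∀ i, i + Nat.count q (Nat.nth p i) = Nat.nth p i := by
    intro i
    have := hsum (Nat.nth p i)
    rwa [Nat.count_nth_of_infinite hinf] at this
  obtain ⟨lam, hlam⟩ := exists_rowLen (fun i => D - Nat.count q (Nat.nth p i))
    (fun a b hab => Nat.sub_le_sub_left (Nat.count_monotone q (hmono.monotone hab)) D) K (by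
      intro k hk
      have h3 : K ≤ Nat.nth p k := le_trans hk (hmono.le_apply)
      have := Nat.count_monotone q h3
      exact Nat.sub_eq_zero_of_le this)
  have hval : ∀ k, (lam.rowLen k : ℤ) - ((k : ℤ) + 1) + (M + 1 - D) = M - (Nat.nth p k : ℕ) := by
    intro k
    rw [hlam]
    have := hcq k
    have := hle (Nat.nth p k)
    omega
  refine ⟨M + 1 - D, lam, ?_⟩
  ext x
  simp only [beta, Set.mem_range, hval]
  constructor
  · rintro ⟨k, rfl⟩
    exact Nat.nth_mem_of_infinite hinf k
  · intro hx
    have hxM : x ≤ M := hM hx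
    have hp : p (M - x).toNat := by
      show M - ((M - x).toNat : ℤ) ∈ B
      rwa [Int.toNat_of_nonneg (by omega), sub_sub_cancel]
    refine ⟨Nat.count p (M - x).toNat, ?_⟩
    rw [Nat.nth_count hp]
    omega

theorem ofBeta_beta (r : ℤ) (lam : YoungDiagram) : ofBeta (beta r lam) = lam := by
  have h : ∃ mu, ∃ r' : ℤ, beta r' mu = beta r lam := ⟨lam, r, rfl⟩
  obtain ⟨r', hr'⟩ := Classical.epsilon_spec h
  exact (beta_inj hr').2

theorem exists_beta_ofBeta {B : Set ℤ} (h1 : BddAbove B) (h2 : BddBelow Bᶜ) :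
    ∃ r : ℤ, beta r (ofBeta B) = B := by
  obtain ⟨r, lam, rfl⟩ := exists_eq_beta h1 h2
  exact ⟨r, by rw [ofBeta_beta]⟩

/-! ### Quotients -/

/-- The component of the `s`-quotient of `lam` labelled by `j = i + sℤ`: the partition with
beta-set `{b : i + s * b ∈ beta 0 lam}`, where `i` is any representative of `j`. -/
noncomputable def quo (s : ℕ) (j : ZMod s) (lam : YoungDiagram) : YoungDiagram :=
  ofBeta {b : ℤ | (j.val : ℤ) + (s : ℤ) * b ∈ beta 0 lam}

/-! ### The largest simultaneous core -/

/-- The partition whose beta-set is the set of integers which are not linear combinations of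
`s` and `t` with non-negative integer coefficients. -/
noncomputable def kappa (s t : ℕ) : YoungDiagram :=
  ofBeta {n : ℤ | ¬ ∃ a b : ℕ, n = (a : ℤ) * s + (b : ℤ) * t}

/-- `kap` is the unique largest `(s, t)`-core. -/
def IsLargestCore (s t : ℕ) (kap : YoungDiagram) : Prop :=
  kap ∈ cores s ∩ cores t ∧ ∀ mu ∈ cores s ∩ cores t, mu ≠ kap → mu.card < kap.card

/-! ### The affine symmetric group and its actions -/

/-- The Coxeter matrix of type `Ã_(s-1)`, with entry `0` standing for `∞`: neighbours on the
cycle `ℤ/sℤ` get the entry `3`, except for `s = 2`, where `i + 1 = i - 1`. -/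
def affineMatrix (s : ℕ) : CoxeterMatrix (ZMod s) where
  M := Matrix.of fun i j =>
    if i = j then 1
    else if j = i + 1 ∧ j = i - 1 then 0
    else if j = i + 1 ∨ j = i - 1 then 3
    else 2
  isSymm := by
    apply Matrix.IsSymm.ext
    intro i j
    have h1 : j = i ↔ i = j := eq_comm
    have h2 : j = i + 1 ↔ i = j - 1 := by rw [eq_sub_iff_add_eq, eq_comm]
    have h3 : j = i - 1 ↔ i = j + 1 := by rw [eq_sub_iff_add_eq, eq_comm]
    simp only [Matrix.of_apply, h1, h2, h3, and_comm, or_comm]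
  diagonal := by intro i; simp
  off_diagonal := by
    intro i j h
    simp only [Matrix.of_apply, if_neg h]
    split_ifs <;> decide

/-- The group `W_s`: the Coxeter group of type `Ã_(s-1)` (for `s ≥ 2`). -/
abbrev W (s : ℕ) : Type := (affineMatrix s).Group

/-- The integer `(s - 1)(t - 1) / 2`; the division is exact when `s` and `t` are coprime. -/
def circ (s t : ℕ) : ℤ := ((s : ℤ) - 1) * ((t : ℤ) - 1) / 2

/-- The level `t` action of the generator `w_i` of `W_s` on an integer `n`. -/
def genFun (s t : ℕ) (i : ZMod s) (n : ℤ) : ℤ :=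
  if (n : ZMod s) = (i - 1) * (t : ZMod s) - (circ s t : ZMod s) then n + t
  else if (n : ZMod s) = i * (t : ZMod s) - (circ s t : ZMod s) then n - t
  else n

theorem natCast_ne_zero {s t : ℕ} (hs : 2 ≤ s) (hst : s.Coprime t) : (t : ZMod s) ≠ 0 := by
  intro h
  have h1 := (ZMod.natCast_eq_zero_iff t s).1 h
  have h2 := Nat.eq_one_of_dvd_coprimes hst dvd_rfl h1
  omega

theorem natCast_cancel {s t : ℕ} (hst : s.Coprime t) {a b : ZMod s}
    (h : a * (t : ZMod s) = b * (t : ZMod s)) : a = b :=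
  ((ZMod.isUnit_iff_coprime t s).2 hst.symm).mul_right_cancel h

theorem genFun_invol {s t : ℕ} (hs : 2 ≤ s) (hst : s.Coprime t) (i : ZMod s) :
    Function.Involutive (genFun s t i) := by
  have h0 := natCast_ne_zero hs hst
  intro n
  unfold genFun
  split_ifs <;> push_cast at * <;> first | omega | grind

/-- The level `t` action of the generator `w_i` of `W_s` on `ℤ`, as a permutation. -/
def genPerm {s t : ℕ} (hs : 2 ≤ s) (hst : s.Coprime t) (i : ZMod s) : Equiv.Perm ℤ :=
  (genFun_invol hs hst i).toPerm

theorem genPerm_mul_self {s t : ℕ} (hs : 2 ≤ s) (hst : s.Coprime t) (i : ZMod s) :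
    genPerm hs hst i * genPerm hs hst i = 1 :=
  Equiv.ext fun n => genFun_invol hs hst i n

theorem genPerm_comm {s t : ℕ} (hs : 2 ≤ s) (hst : s.Coprime t) (i j : ZMod s) (h1 : j ≠ i + 1)
    (h2 : j ≠ i - 1) : genPerm hs hst i * genPerm hs hst j = genPerm hs hst j * genPerm hs hst i := by
  by_cases hij : i = j
  · rw [hij]
  have h0 := natCast_ne_zero hs hst
  have e1 : i * (t : ZMod s) ≠ j * t := fun h => hij (natCast_cancel hst h)
  have e2 : j * (t : ZMod s) ≠ (i + 1) * t := fun h => h1 (natCast_cancel hst h)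
  have e3 : j * (t : ZMod s) ≠ (i - 1) * t := fun h => h2 (natCast_cancel hst h)
  ext n
  show genFun s t i (genFun s t j n) = genFun s t j (genFun s t i n)
  unfold genFun
  split_ifs <;> push_cast at * <;> first | omega | grind

theorem genPerm_braid {s t : ℕ} (hs : 2 ≤ s) (hst : s.Coprime t) (i : ZMod s)
    (h1 : i + 1 ≠ i - 1) :
    genPerm hs hst i * genPerm hs hst (i + 1) * genPerm hs hst i
      = genPerm hs hst (i + 1) * genPerm hs hst i * genPerm hs hst (i + 1) := by
  have h0 := natCast_ne_zero hs hst
  have e1 : (i + 1) * (t : ZMod s) ≠ (i - 1) * t := fun h => h1 (natCast_cancel hst h)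
  have up : ∀ (k : ZMod s) (m : ℤ), (m : ZMod s) = (k - 1) * (t : ZMod s) - (circ s t : ZMod s) →
      genFun s t k m = m + t := fun k m h => if_pos h
  have down : ∀ (k : ZMod s) (m : ℤ), (m : ZMod s) = k * (t : ZMod s) - (circ s t : ZMod s) →
      genFun s t k m = m - t := fun k m h => by
    have : (m : ZMod s) ≠ (k - 1) * (t : ZMod s) - (circ s t : ZMod s) := by grind
    rw [genFun, if_neg this, if_pos h]
  have fix : ∀ (k : ZMod s) (m : ℤ), (m : ZMod s) ≠ (k - 1) * (t : ZMod s) - (circ s t : ZMod s) →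
      (m : ZMod s) ≠ k * (t : ZMod s) - (circ s t : ZMod s) →
      genFun s t k m = m := fun k m h h' => by
    rw [genFun, if_neg h, if_neg h']
  ext n
  show genFun s t i (genFun s t (i + 1) (genFun s t i n))
    = genFun s t (i + 1) (genFun s t i (genFun s t (i + 1) n))
  by_cases c0 : (n : ZMod s) = (i - 1) * (t : ZMod s) - (circ s t : ZMod s)
  · rw [up i n c0, up (i + 1) (n + t) (by push_cast; grind),
      fix i (n + t + t) (by push_cast; grind) (by push_cast; grind),
      fix (i + 1) n (by grind) (by grind), up i n c0, up (i + 1) (n + t) (by push_cast; grind)]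
  by_cases c1 : (n : ZMod s) = i * (t : ZMod s) - (circ s t : ZMod s)
  · rw [down i n c1, fix (i + 1) (n - t) (by push_cast; grind) (by push_cast; grind),
      up i (n - t) (by push_cast; grind), up (i + 1) n (by grind),
      fix i (n + t) (by push_cast; grind) (by push_cast; grind),
      down (i + 1) (n + t) (by push_cast; grind)]
    ring
  by_cases c2 : (n : ZMod s) = (i + 1) * (t : ZMod s) - (circ s t : ZMod s)
  · rw [fix i n c0 c1, down (i + 1) n c2, down i (n - t) (by push_cast; grind),
      fix (i + 1) (n - t - t) (by push_cast; grind) (by push_cast; grind)]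
  · rw [fix i n c0 c1, fix (i + 1) n (by grind) c2, fix i n c0 c1, fix (i + 1) n (by grind) c2]

theorem pow_three_of_braid {G : Type*} [Group G] {a b : G} (ha : a * a = 1) (hb : b * b = 1)
    (h : a * b * a = b * a * b) : (a * b) ^ 3 = 1 := by
  calc (a * b) ^ 3 = (a * b * a) * (b * a * b) := by simp only [pow_succ, pow_zero, one_mul, mul_assoc]
    _ = (a * b * a) * (a * b * a) := by rw [← h]
    _ = a * b * (a * a) * b * a := by simp only [mul_assoc]
    _ = a * (b * b) * a := by rw [ha, mul_one]; simp only [mul_assoc]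
    _ = 1 := by rw [hb, mul_one, ha]

theorem genPerm_liftable {s t : ℕ} (hs : 2 ≤ s) (hst : s.Coprime t) :
    (affineMatrix s).IsLiftable (genPerm hs hst) := by
  intro i j
  show (genPerm hs hst i * genPerm hs hst j) ^ (if i = j then 1
    else if j = i + 1 ∧ j = i - 1 then 0
    else if j = i + 1 ∨ j = i - 1 then 3
    else 2) = 1
  split_ifs with h1 h2 h3
  · rw [h1, pow_one, genPerm_mul_self]
  · exact pow_zero _
  · apply pow_three_of_braid (genPerm_mul_self hs hst i) (genPerm_mul_self hs hst j)
    rcases h3 with h3 | h3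
    · subst h3
      exact genPerm_braid hs hst i fun h => h2 ⟨rfl, h⟩
    · obtain rfl : i = j + 1 := by rw [h3]; ring
      exact (genPerm_braid hs hst j fun h => h2 ⟨by rw [h]; ring, h3⟩).symm
  · push Not at h3
    have hc := genPerm_comm hs hst i j h3.1 h3.2
    calc (genPerm hs hst i * genPerm hs hst j) ^ 2
        = (genPerm hs hst i * genPerm hs hst j) * (genPerm hs hst j * genPerm hs hst i) := by
          rw [pow_two, ← hc]
      _ = genPerm hs hst i * (genPerm hs hst j * genPerm hs hst j) * genPerm hs hst i := by
          simp only [mul_assoc]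
      _ = 1 := by rw [genPerm_mul_self, mul_one, genPerm_mul_self]

/-- The level `t` action of `W_s` on `ℤ`. -/
noncomputable def intAction {s t : ℕ} (hs : 2 ≤ s) (hst : s.Coprime t) : W s →* Equiv.Perm ℤ :=
  (affineMatrix s).toCoxeterSystem.lift ⟨genPerm hs hst, genPerm_liftable hs hst⟩

theorem intAction_simple {s t : ℕ} (hs : 2 ≤ s) (hst : s.Coprime t) (i : ZMod s) :
    intAction hs hst ((affineMatrix s).simple i) = genPerm hs hst i := by
  rw [← CoxeterMatrix.toCoxeterSystem_simple]
  exact CoxeterSystem.lift_apply_simple _ _ i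

/-- A permutation of `ℤ` which maps each beta-set `beta 0 lam` to one of the same kind. -/
def Preserves (σ : Equiv.Perm ℤ) : Prop := ∀ lam, ∃ mu, beta 0 mu = σ '' beta 0 lam

theorem beta_window (r : ℤ) (lam : YoungDiagram) :
    ∃ L0 : ℤ, ∀ L ≤ L0, Iio L ⊆ beta r lam ∧ (beta r lam ∩ Ici L).Finite ∧
      ((beta r lam ∩ Ici L).ncard : ℤ) = r - L := by
  obtain ⟨N, hN⟩ := rowLen_eventually_zero lam
  refine ⟨r - N, fun L hL => ?_⟩
  have hanti := beta_strictMono r lam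
  have hinj : Function.Injective fun k : ℕ => (lam.rowLen k : ℤ) - ((k : ℤ) + 1) + r :=
    fun a b h => hanti.injective (congrArg OrderDual.toDual h)
  have himg : beta r lam ∩ Ici L = (fun k : ℕ => (lam.rowLen k : ℤ) - ((k : ℤ) + 1) + r) ''
      (Finset.range (r - L).toNat : Set ℕ) := by
    ext x
    simp only [beta, mem_inter_iff, Set.mem_range, mem_Ici, mem_image, Finset.coe_range, mem_Iio]
    constructor
    · rintro ⟨⟨k, rfl⟩, hk⟩
      refine ⟨k, ?_, rfl⟩
      by_contra hc
      rw [hN k (by omega)] at hk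
      omega
    · rintro ⟨k, hk, rfl⟩
      exact ⟨⟨k, rfl⟩, by omega⟩
  refine ⟨fun x hx => ?_, ?_, ?_⟩
  · have hx' : x < L := hx
    refine ⟨(r - 1 - x).toNat, ?_⟩
    simp only
    rw [hN _ (by omega)]
    omega
  · rw [himg]
    exact (Finset.finite_toSet _).image _
  · rw [himg, ncard_image_of_injective _ hinj, ncard_coe_finset,
      Finset.card_range]
    omega

theorem genPerm_preserves {s t : ℕ} (hs : 2 ≤ s) (hst : s.Coprime t) (i : ZMod s) :
    Preserves (genPerm hs hst i) := by
  intro lam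
  have h0 := natCast_ne_zero hs hst
  set σ := genPerm hs hst i with hσ
  have happ : ∀ n, σ n = genFun s t i n := fun n => rfl
  have hinv : ∀ n, σ (σ n) = n := fun n => genFun_invol hs hst i n
  have hdisp : ∀ n, n - t ≤ σ n ∧ σ n ≤ n + t := by
    intro n
    rw [happ]
    unfold genFun
    split_ifs <;> constructor <;> omega
  have himg : ∀ (S : Set ℤ) n, n ∈ σ '' S ↔ σ n ∈ S := by
    intro S n
    constructor
    · rintro ⟨m, hm, rfl⟩
      rwa [hinv]
    · intro h
      exact ⟨σ n, h, hinv n⟩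
  obtain ⟨L0, hL0⟩ := beta_window 0 lam
  obtain ⟨r, mu, hmu⟩ := exists_eq_beta (B := σ '' beta 0 lam)
    (by
      refine ⟨max L0 0 + lam.rowLen 0 + t, ?_⟩
      rintro _ ⟨_, ⟨k, rfl⟩, rfl⟩
      have := lam.rowLen_anti 0 k (Nat.zero_le k)
      have h := (hdisp ((lam.rowLen k : ℤ) - ((k : ℤ) + 1) + 0)).2
      have := le_max_right L0 0
      simp only at h ⊢
      omega)
    (by
      refine ⟨L0 - t, fun n hn => ?_⟩
      by_contra hc
      apply hn
      rw [himg]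
      have := (hdisp n).2
      exact (hL0 L0 le_rfl).1 (show σ n < L0 by omega))
  obtain ⟨L1, hL1⟩ := beta_window r mu
  set L := min L0 L1 - t with hL
  have hl0 : L + t ≤ L0 := by have := min_le_left L0 L1; omega
  have hl1 : L + t ≤ L1 := by have := min_le_right L0 L1; omega
  let U : Set ℤ := {n | n < L ∨
    (n < L + t ∧ (n : ZMod s) = i * (t : ZMod s) - (circ s t : ZMod s))}
  have hUU : ∀ n, n ∈ U → σ n ∈ U := by
    intro n hn
    rw [happ]
    simp only [U, mem_ofPred_eq, genFun] at hn ⊢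
    split_ifs with ha hb
    · right
      refine ⟨?_, by push_cast; rw [ha]; ring⟩
      rcases hn with hn | hn
      · omega
      · exact absurd (ha.symm.trans hn.2) (by grind)
    · left
      rcases hn with hn | hn <;> omega
    · exact Or.inl (hn.resolve_right fun h => hb h.2)
  have hUiff : ∀ n, σ n ∈ U ↔ n ∈ U := fun n =>
    ⟨fun h => by have := hUU _ h; rwa [hinv] at this, hUU n⟩
  have hUsub : U ⊆ Iio (L + t) := by
    rintro n (hn | hn)
    · show n < L + t
      omega
    · exact hn.1
  have hcard : (beta r mu \ U).ncard = (beta 0 lam \ U).ncard := by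
    rw [hmu, ← ncard_image_of_injective (beta 0 lam \ U) σ.injective]
    congr 1
    ext n
    rw [mem_sdiff, himg, himg, mem_sdiff, hUiff]
  have hsplit : ∀ (q : ℤ) (nu : YoungDiagram), U ⊆ beta q nu → (beta q nu ∩ Ici L).Finite →
      (beta q nu ∩ Ici L).ncard = (beta q nu \ U).ncard + (U ∩ Ici L).ncard := by
    intro q nu hsub hfin
    have heq : beta q nu ∩ Ici L = (beta q nu \ U) ∪ (U ∩ Ici L) := by
      ext n
      constructor
      · rintro ⟨h1, h2⟩
        by_cases h3 : n ∈ U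
        · exact Or.inr ⟨h3, h2⟩
        · exact Or.inl ⟨h1, h3⟩
      · rintro (⟨h1, h2⟩ | ⟨h1, h2⟩)
        · refine ⟨h1, ?_⟩
          by_contra hc
          exact h2 (Or.inl (not_le.1 hc))
        · exact ⟨hsub h1, h2⟩
    have hd : Disjoint (beta q nu \ U) (U ∩ Ici L) :=
      Set.disjoint_left.2 fun n h1 h2 => h1.2 h2.1
    rw [heq] at hfin ⊢
    exact ncard_union_eq hd (hfin.subset subset_union_left) (hfin.subset subset_union_right)
  have hs0 := hsplit 0 lam (hUsub.trans (hL0 _ hl0).1) (hL0 L (by omega)).2.1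
  have hs1 := hsplit r mu (hUsub.trans (hL1 _ hl1).1) (hL1 L (by omega)).2.1
  have hc0 := (hL0 L (by omega)).2.2
  have hc1 := (hL1 L (by omega)).2.2
  have hr : r = 0 := by omega
  exact ⟨mu, by rw [← hmu, hr]⟩

theorem intAction_preserves {s t : ℕ} (hs : 2 ≤ s) (hst : s.Coprime t) (w : W s) :
    Preserves (intAction hs hst w) := by
  induction w using (affineMatrix s).toCoxeterSystem.simple_induction with
  | simple i =>
    rw [CoxeterMatrix.toCoxeterSystem_simple, intAction_simple]
    exact genPerm_preserves hs hst i
  | one => exact fun lam => ⟨lam, by simp⟩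
  | mul w w' h h' =>
    intro lam
    obtain ⟨mu, hmu⟩ := h' lam
    obtain ⟨nu, hnu⟩ := h mu
    exact ⟨nu, by rw [hnu, hmu, map_mul, ← Set.image_comp, Equiv.Perm.coe_mul]⟩

/-- The image of a partition under a permutation of `ℤ`, through its beta-set. -/
noncomputable def moveBy (σ : Equiv.Perm ℤ) (lam : YoungDiagram) : YoungDiagram :=
  ofBeta (σ '' beta 0 lam)

theorem beta_moveBy {σ : Equiv.Perm ℤ} (h : Preserves σ) (lam : YoungDiagram) :
    beta 0 (moveBy σ lam) = σ '' beta 0 lam := by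
  obtain ⟨mu, hmu⟩ := h lam
  rw [moveBy, ← hmu, ofBeta_beta]

/-- The level `t` action of `W_s` on the set of all partitions: the beta-set of `w lam` is the
image of the beta-set of `lam` under the level `t` action of `w` on `ℤ`, see `beta_action`. -/
noncomputable def action {s t : ℕ} (hs : 2 ≤ s) (hst : s.Coprime t) :
    W s →* Equiv.Perm YoungDiagram :=
  MonoidHom.toHomPerm
    { toFun := fun w => (moveBy (intAction hs hst w) : Function.End YoungDiagram)
      map_one' := by
        funext lam
        show moveBy (intAction hs hst 1) lam = lam
        rw [moveBy, map_one, Equiv.Perm.coe_one, Set.image_id, ofBeta_beta]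
      map_mul' := by
        intro w w'
        funext lam
        show moveBy (intAction hs hst (w * w')) lam
          = moveBy (intAction hs hst w) (moveBy (intAction hs hst w') lam)
        rw [moveBy, moveBy, beta_moveBy (intAction_preserves hs hst w'), map_mul,
          Equiv.Perm.coe_mul, Set.image_comp] }

theorem beta_action {s t : ℕ} (hs : 2 ≤ s) (hst : s.Coprime t) (w : W s) (lam : YoungDiagram) :
    beta 0 (action hs hst w lam) = intAction hs hst w '' beta 0 lam :=
  beta_moveBy (intAction_preserves hs hst w) lam

theorem intAction_commute {s t : ℕ} (hs : 2 ≤ s) (ht : 2 ≤ t) (hst : s.Coprime t) (w : W s)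
    (x : W t) : Commute (intAction hs hst w) (intAction ht hst.symm x) := by
  induction w using (affineMatrix s).toCoxeterSystem.simple_induction with
  | one => rw [map_one]; exact Commute.one_left _
  | mul w w' h h' => rw [map_mul]; exact h.mul_left h'
  | simple i =>
    induction x using (affineMatrix t).toCoxeterSystem.simple_induction with
    | one => rw [map_one]; exact Commute.one_right _
    | mul x x' h h' => rw [map_mul]; exact h.mul_right h'
    | simple j =>
      rw [CoxeterMatrix.toCoxeterSystem_simple, CoxeterMatrix.toCoxeterSystem_simple,
        intAction_simple, intAction_simple]
      ext n
      show genFun s t i (genFun t s j n) = genFun t s j (genFun s t i n)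
      have hss : ((s : ℤ) : ZMod s) = 0 := by simp
      have htt : ((t : ℤ) : ZMod t) = 0 := by simp
      unfold genFun
      split_ifs <;> simp only [Int.cast_add, Int.cast_sub, hss, htt, add_zero, sub_zero] at * <;>
        first | omega | contradiction

theorem action_commute {s t : ℕ} (hs : 2 ≤ s) (ht : 2 ≤ t) (hst : s.Coprime t) (w : W s)
    (x : W t) : Commute (action hs hst w) (action ht hst.symm x) := by
  ext1 lam
  refine (beta_inj (r := 0) (r' := 0) ?_).2
  show beta 0 (action hs hst w (action ht hst.symm x lam))
    = beta 0 (action ht hst.symm x (action hs hst w lam))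
  rw [beta_action, beta_action, beta_action, beta_action, ← Set.image_comp, ← Set.image_comp,
    ← Equiv.Perm.coe_mul, ← Equiv.Perm.coe_mul, (intAction_commute hs ht hst w x).eq]

/-- The action of `W_s × W_t` on the set of all partitions, where `W_s` acts at level `t` and
`W_t` acts at level `s`. -/
noncomputable def prodAction {s t : ℕ} (hs : 2 ≤ s) (ht : 2 ≤ t) (hst : s.Coprime t) :
    W s × W t →* Equiv.Perm YoungDiagram :=
  (action hs hst).noncommCoprod (action ht hst.symm) (action_commute hs ht hst)

/-- The orbit of `W_s × W_t` containing the partition `kappa s t`. -/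
def kappaOrbit {s t : ℕ} (hs : 2 ≤ s) (ht : 2 ≤ t) (hst : s.Coprime t) : Set YoungDiagram :=
  Set.range fun g : W s × W t => prodAction hs ht hst g (kappa s t)

end KappaOrbit

open KappaOrbit

namespace KappaOrbit

open Set

/-! ### Cores and beta-sets -/

/-! Since `s` and `t` are coprime, every integer is `a * s + k * t - circ s t`, with `(a, k)` unique
up to `(a + t * q, k - s * q)`. In these coordinates `W s` at level `t` acts on `k` alone, by its
level one action (`intAction_coordinates`), and `W t` acts likewise on `a`. The beta-set of `kappa s
t` is given by `a / t + k / s < 0` with floor division (`mem_beta_kappa`), so that of its image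
under `(w, x)` is given by `x⁻¹ a / t + w⁻¹ k / s < 0` (`mem_beta_orbit`). For fixed `a` this says
that a translate of `k` by a multiple of `s` lies in the beta-set of `w ⊥`; hence the `t`-quotient
component at `0` is `w ⊥`, and symmetrically the `s`-quotient component is `x ⊥`. Equivariance is
then immediate. Surjectivity is the transitivity of the level one action on cores
(`mem_cores_iff_exists_action`), and injectivity holds because the inequality depends on `w` and `x`
only through `w ⊥` and `x ⊥` (`orbit_ext`).

For maximality, an `s`-core is encoded by its runner `m`, the least gap in each class modulo `s`.
The sum of `m` is fixed, the size grows with the sum of squares, and being a `t`-core means `m (c +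
t) ≤ m c + t`. The sum of squares is then bounded, with equality only for an arithmetic progression
of step `t` (`sum_sq_le`, `exists_isProgression`). The sum fixes that progression, and `kappa s t`
realises it. -/

theorem rim_content_injOn (lam : YoungDiagram) : InjOn content (rim lam) := by
  have key : ∀ {i j i' j' : ℕ}, (i, j) ∈ rim lam → (i', j') ∈ rim lam →
      content (i, j) = content (i', j') → i' ≤ i := by
    intro i j i' j' h h' hc
    simp only [content] at hc
    by_contra hlt
    exact h.2 (lam.up_left_mem (show i + 1 ≤ i' by omega) (show j + 1 ≤ j' by omega) h'.1)
  rintro ⟨i, j⟩ h ⟨i', j'⟩ h' hc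
  have h1 := key h h' hc
  have h2 := key h' h hc.symm
  simp only [content] at hc
  ext <;> simp only <;> omega

/-- Every diagonal that meets a partition meets its rim. -/
theorem exists_rim_of_mem {lam : YoungDiagram} {i j : ℕ} (h : (i, j) ∈ lam) :
    ∃ x ∈ rim lam, content x = content (i, j) := by
  have hex : ∃ n, (i + n, j + n) ∉ lam := by
    obtain ⟨N, hN⟩ := rowLen_eventually_zero lam
    refine ⟨N, fun hc => ?_⟩
    have := YoungDiagram.mem_iff_lt_rowLen.1 hc
    rw [hN _ (by omega)] at this
    omega
  classical
  have h0 : Nat.find hex ≠ 0 := fun h0 => by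
    have := Nat.find_spec hex
    rw [h0] at this
    exact this h
  obtain ⟨n, hn⟩ := Nat.exists_eq_succ_of_ne_zero h0
  refine ⟨(i + n, j + n), ⟨?_, ?_⟩, by simp [content]⟩
  · exact not_not.1 (Nat.find_min hex (by omega))
  · have := Nat.find_spec hex
    rw [hn] at this
    exact this

/-- The contents of the rim cells of a partition form an interval. -/
theorem exists_rim_between {lam : YoungDiagram} {x z : ℕ × ℕ} (hx : x ∈ lam) (hz : z ∈ lam)
    {d : ℤ} (h1 : content x ≤ d) (h2 : d ≤ content z) : ∃ y ∈ rim lam, content y = d := by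
  obtain ⟨i, j⟩ := x
  obtain ⟨i', j'⟩ := z
  simp only [content] at h1 h2
  -- Diagonal `d` starts at `(0, d)` or at `(-d, 0)`; this cell lies weakly above and to the left of
  -- `z` or of `x` respectively.
  rcases le_total 0 d with hd | hd
  · obtain ⟨y, hy, hc⟩ := exists_rim_of_mem (lam.up_left_mem (show 0 ≤ i' by omega)
      (show d.toNat ≤ j' by omega) hz)
    exact ⟨y, hy, by rw [hc]; simp only [content]; omega⟩
  · obtain ⟨y, hy, hc⟩ := exists_rim_of_mem (lam.up_left_mem (show (-d).toNat ≤ i by omega)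
      (show 0 ≤ j by omega) hx)
    exact ⟨y, hy, by rw [hc]; simp only [content]; omega⟩

theorem mem_beta_zero {lam : YoungDiagram} {x : ℤ} :
    x ∈ beta 0 lam ↔ ∃ k : ℕ, (lam.rowLen k : ℤ) = x + k + 1 := by
  simp only [beta, Set.mem_range]
  constructor <;> rintro ⟨k, hk⟩ <;> exact ⟨k, by omega⟩

theorem card_of_content_image {lam : YoungDiagram} {H : Finset (ℕ × ℕ)} {a b : ℤ}
    (hH : ∀ x ∈ H, x ∈ rim lam) (himg : ∀ d, (∃ x ∈ H, content x = d) ↔ a < d ∧ d ≤ b) :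
    H.card = (b - a).toNat := by
  have : H.image content = Finset.Ioc a b := by
    ext d
    rw [Finset.mem_image, himg, Finset.mem_Ioc]
  rw [← Int.card_Ioc, ← this, Finset.card_image_of_injOn]
  exact (rim_content_injOn lam).mono hH

/-- The cell of largest content in the hook ends its row and the cell of smallest content ends its
column, as otherwise the removal would not leave a diagram. The row end gives a beta-number `x`, the
column end a gap, and counting contents puts them `s` apart. -/
theorem exists_beta_of_isRimHook {s : ℕ} (hs : 1 ≤ s) {lam : YoungDiagram} {H : Finset (ℕ × ℕ)}
    (hH : IsRimHook s lam H) : ∃ x ∈ beta 0 lam, x - s ∉ beta 0 lam := by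
  obtain ⟨hrim, hcard, hcons, mu, hmu⟩ := hH
  have hmem : ∀ x, x ∈ mu ↔ x ∈ lam ∧ x ∉ H := fun x => by
    rw [← YoungDiagram.mem_cells, hmu, Finset.mem_sdiff, YoungDiagram.mem_cells]
  have hne : H.Nonempty := Finset.card_pos.1 (by omega)
  obtain ⟨⟨i, j⟩, hz, hmax⟩ := H.exists_max_image content hne
  obtain ⟨⟨i', j'⟩, hy, hmin⟩ := H.exists_min_image content hne
  have hright : (i, j + 1) ∉ lam := fun hc => by
    have hr : (i, j + 1) ∈ rim lam :=
      ⟨hc, fun h => (hrim _ hz).2 (lam.up_left_mem le_rfl (Nat.le_succ _) h)⟩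
    have hnH : (i, j + 1) ∉ H := fun h => by
      have := hmax _ h
      simp only [content] at this
      omega
    have := mu.up_left_mem le_rfl (Nat.le_succ j) ((hmem _).2 ⟨hc, hnH⟩)
    exact ((hmem _).1 this).2 hz
  have hdown : (i' + 1, j') ∉ lam := fun hc => by
    have hr : (i' + 1, j') ∈ rim lam :=
      ⟨hc, fun h => (hrim _ hy).2 (lam.up_left_mem (Nat.le_succ _) le_rfl h)⟩
    have hnH : (i' + 1, j') ∉ H := fun h => by
      have := hmin _ h
      simp only [content] at this
      omega
    have := mu.up_left_mem (Nat.le_succ i') le_rfl ((hmem _).2 ⟨hc, hnH⟩)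
    exact ((hmem _).1 this).2 hy
  have hc := card_of_content_image (a := content (i', j') - 1) (b := content (i, j)) hrim (by
    intro d
    constructor
    · rintro ⟨x, hx, rfl⟩
      have := hmin x hx
      have := hmax x hx
      omega
    · rintro ⟨h1, h2⟩
      obtain ⟨w, hw, rfl⟩ := exists_rim_between (hrim _ hy).1 (hrim _ hz).1
        (show content (i', j') ≤ d by omega) h2
      exact ⟨w, hcons _ hy _ hz _ hw (by omega) h2, rfl⟩)
  have hle := hmin _ hz
  rw [YoungDiagram.mem_iff_lt_rowLen] at hright hdown
  have hzl := YoungDiagram.mem_iff_lt_rowLen.1 (hrim _ hz).1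
  have hyl := YoungDiagram.mem_iff_lt_rowLen.1 (hrim _ hy).1
  simp only [content] at hc hle
  refine ⟨(j : ℤ) - i, mem_beta_zero.2 ⟨i, by omega⟩, fun hb => ?_⟩
  obtain ⟨k, hk⟩ := mem_beta_zero.1 hb
  rcases le_or_gt k i' with hk' | hk'
  · have := lam.rowLen_anti _ _ hk'
    omega
  · have := lam.rowLen_anti _ _ (Nat.succ_le_of_lt hk')
    simp only [Nat.succ_eq_add_one] at this
    omega

/-- The hook consists of the rim cells with content in `(x - s, x]`. The beta-number `x` is a row
end and the gap `x - s` a column end, so nothing to the right of or below a hook cell survives its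
removal. -/
theorem exists_isRimHook_of_beta {s : ℕ} {lam : YoungDiagram} {x : ℤ}
    (hx : x ∈ beta 0 lam) (hxs : x - s ∉ beta 0 lam) : ∃ H, IsRimHook s lam H := by
  classical
  obtain ⟨k, hk⟩ := mem_beta_zero.1 hx
  have hs : s ≠ 0 := fun h => hxs (by simpa [h] using hx)
  have hnot : ∀ l : ℕ, (lam.rowLen l : ℤ) ≠ x - s + l + 1 := fun l hl =>
    hxs (mem_beta_zero.2 ⟨l, hl⟩)
  have hex : ∃ l : ℕ, (lam.rowLen l : ℤ) < x - s + l + 1 := by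
    obtain ⟨N, hN⟩ := rowLen_eventually_zero lam
    exact ⟨N + (s - x).toNat, by rw [hN _ (by omega)]; omega⟩
  have hkey : (lam.rowLen (Nat.find hex) : ℤ) < x - s + Nat.find hex + 1 := Nat.find_spec hex
  have hkl : k < Nat.find hex := by
    by_contra hc
    have := lam.rowLen_anti _ _ (not_lt.1 hc)
    omega
  -- Row `l` is the last one with beta-number above `x - s`, equality being excluded by the gap; it
  -- therefore contains a cell of content `x - s + 1`.
  obtain ⟨l, hl⟩ : ∃ l, Nat.find hex = l + 1 := ⟨Nat.find hex - 1, by omega⟩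
  have hl' := Nat.find_min hex (show l < Nat.find hex by omega)
  have hl'' := hnot l
  rw [hl] at hkey hkl
  push_cast at hkey
  have hlow : (l, (x - s + l + 1).toNat) ∈ lam := by
    rw [YoungDiagram.mem_iff_lt_rowLen]
    omega
  have hanti := lam.rowLen_anti k l (by omega)
  have hhigh : (k, (x + k).toNat) ∈ lam := by
    rw [YoungDiagram.mem_iff_lt_rowLen]
    omega
  let H : Finset (ℕ × ℕ) :=
    lam.cells.filter fun y => y ∈ rim lam ∧ x - s < content y ∧ content y ≤ x
  have hH : ∀ y, y ∈ H ↔ y ∈ rim lam ∧ x - s < content y ∧ content y ≤ x := fun y => by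
    rw [Finset.mem_filter, YoungDiagram.mem_cells]
    exact ⟨fun h => h.2, fun h => ⟨h.1.1, h⟩⟩
  refine ⟨H, fun y hy => ((hH y).1 hy).1, ?_, ?_, ?_⟩
  · rw [card_of_content_image (lam := lam) (a := x - s) (b := x) fun y hy => ((hH y).1 hy).1]
    · omega
    · intro d
      constructor
      · rintro ⟨y, hy, rfl⟩
        exact ((hH y).1 hy).2
      · rintro ⟨h1, h2⟩
        obtain ⟨y, hy, rfl⟩ := exists_rim_between hlow hhigh (d := d)
          (by simp only [content]; omega) (by simp only [content]; omega)
        exact ⟨y, (hH y).2 ⟨hy, h1, h2⟩, rfl⟩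
  · intro a ha c hc b hb h1 h2
    rw [hH] at ha hc ⊢
    exact ⟨hb, by omega, by omega⟩
  · have hup : ∀ u v : ℕ × ℕ, u ≤ v → v ∈ lam → u ∈ H → v ∈ H := by
      rintro ⟨i, j⟩ ⟨i', j'⟩ ⟨h1, h2⟩ hv hu
      rw [hH] at hu ⊢
      obtain ⟨⟨hu1, hu2⟩, hu3, hu4⟩ := hu
      simp only [content] at h1 h2 hu2 hu3 hu4 ⊢
      have hrim : (i', j') ∈ rim lam := ⟨hv, fun h => hu2 (lam.up_left_mem
        (show i + 1 ≤ i' + 1 by omega) (show j + 1 ≤ j' + 1 by omega) h)⟩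
      have hor : i' = i ∨ j' = j := by
        by_contra hc
        exact hu2 (lam.up_left_mem (show i + 1 ≤ i' by omega) (show j + 1 ≤ j' by omega) hv)
      rw [YoungDiagram.mem_iff_lt_rowLen] at hv hu1 hu2
      rcases hor with rfl | rfl
      · refine ⟨hrim, by omega, ?_⟩
        by_contra hc
        rcases lt_or_ge i' k with hik | hik
        · have := lam.rowLen_anti _ _ (Nat.succ_le_of_lt hik)
          simp only [Nat.succ_eq_add_one] at this
          omega
        · have := lam.rowLen_anti _ _ hik
          omega
      · refine ⟨hrim, ?_, by omega⟩
        by_contra hc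
        -- In the row where column `j'` meets content `x - s`, monotonicity from both sides forces
        -- length `j' + 1`, which would make `x - s` a beta-number.
        have h3 := lam.rowLen_anti (i + 1) ((j' : ℤ) - (x - s)).toNat (by omega)
        have h4 := lam.rowLen_anti ((j' : ℤ) - (x - s)).toNat i' (by omega)
        exact hnot ((j' : ℤ) - (x - s)).toNat (by omega)
    refine ⟨⟨lam.cells \ H, ?_⟩, rfl⟩
    intro v u huv hv
    rw [Finset.mem_coe, Finset.mem_sdiff, YoungDiagram.mem_cells] at hv ⊢
    exact ⟨lam.isLowerSet huv hv.1, fun hu => hv.2 (hup u v huv hv.1 hu)⟩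

/-- A partition is an `s`-core exactly if its beta-set is closed under subtracting `s`. -/
theorem mem_cores_iff {s : ℕ} (hs : 1 ≤ s) {lam : YoungDiagram} :
    lam ∈ cores s ↔ ∀ x ∈ beta 0 lam, x - s ∈ beta 0 lam := by
  constructor
  · intro h x hx
    by_contra hc
    exact h (exists_isRimHook_of_beta hx hc)
  · rintro h ⟨H, hH⟩
    obtain ⟨x, hx, hxs⟩ := exists_beta_of_isRimHook hs hH
    exact hxs (h x hx)

theorem mem_beta_iff {r x : ℤ} {lam : YoungDiagram} : x ∈ beta r lam ↔ x - r ∈ beta 0 lam := by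
  simp only [beta, Set.mem_range]
  constructor <;> rintro ⟨k, hk⟩ <;> exact ⟨k, by omega⟩

/-! ### Runners of the abacus -/

/-- `m c` is the least element of the residue class `c` outside `B`, and `B` consists of all
integers below these in their classes. -/
structure IsRunner (s : ℕ) (m : ZMod s → ℤ) (B : Set ℤ) : Prop where
  cast_eq : ∀ c, (m c : ZMod s) = c
  mem_iff : ∀ n : ℤ, n ∈ B ↔ n < m n

theorem sub_nsmul_mem {s : ℕ} {B : Set ℤ} (hB : ∀ x ∈ B, x - s ∈ B) {x : ℤ} (hx : x ∈ B) (q : ℕ) :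
    x - q * s ∈ B := by
  induction q with
  | zero => simpa using hx
  | succ q ih =>
    have := hB _ ih
    push_cast
    rwa [add_mul, one_mul, ← sub_sub]

theorem cast_eq_iff_exists {s : ℕ} {a b : ℤ} : (a : ZMod s) = b ↔ ∃ q : ℤ, b = a + q * s := by
  rw [ZMod.intCast_eq_intCast_iff_dvd_sub]
  constructor
  · rintro ⟨q, hq⟩
    exact ⟨q, by rw [mul_comm]; omega⟩
  · rintro ⟨q, hq⟩
    exact ⟨q, by rw [mul_comm]; omega⟩

theorem exists_isRunner {s : ℕ} [NeZero s] {r : ℤ} {lam : YoungDiagram}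
    (hB : ∀ x ∈ beta r lam, x - s ∈ beta r lam) : ∃ m, IsRunner s m (beta r lam) := by
  have hs : 0 < s := NeZero.pos s
  obtain ⟨L0, hL0⟩ := beta_window r lam
  have hlow : ∀ n, n ∉ beta r lam → L0 ≤ n := fun n hn => by
    by_contra hc
    exact hn ((hL0 L0 le_rfl).1 (not_le.1 hc))
  have hup : ∀ n : ℤ, lam.rowLen 0 + r ≤ n → n ∉ beta r lam := by
    rintro n hn ⟨k, hk⟩
    have := lam.rowLen_anti 0 k (Nat.zero_le k)
    simp only at hk
    omega
  have hex : ∀ c : ZMod s, ∃ x : ℤ, ((x : ZMod s) = c ∧ x ∉ beta r lam) ∧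
      ∀ z : ℤ, ((z : ZMod s) = c ∧ z ∉ beta r lam) → x ≤ z := by
    intro c
    apply Int.exists_least_of_bdd
    · exact ⟨L0, fun z hz => hlow z hz.2⟩
    -- An element of the class `c` above every beta-number.
    · refine ⟨c.val + s * (|(lam.rowLen 0 + r : ℤ)|), by simp, hup _ ?_⟩
      have h1 := le_abs_self (lam.rowLen 0 + r : ℤ)
      have h2 := abs_nonneg (lam.rowLen 0 + r : ℤ)
      have h3 : (1 : ℤ) ≤ s := by exact_mod_cast hs
      nlinarith
  choose m hm1 hm2 using hex
  refine ⟨m, fun c => (hm1 c).1, fun n => ⟨fun hn => ?_, fun hn => ?_⟩⟩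
  · by_contra hc
    obtain ⟨q, hq⟩ := cast_eq_iff_exists.1 (hm1 (n : ZMod s)).1
    have hq0 : 0 ≤ q := by
      by_contra hq0
      have : q * s < 0 := mul_neg_of_neg_of_pos (not_le.1 hq0) (by exact_mod_cast hs)
      omega
    lift q to ℕ using hq0
    apply (hm1 (n : ZMod s)).2
    have := sub_nsmul_mem hB hn q
    rwa [show n - q * s = m n by omega] at this
  · by_contra hc
    have := hm2 n n ⟨rfl, hc⟩
    omega

theorem IsRunner.eq_of_lt {s : ℕ} {m : ZMod s → ℤ} {B : Set ℤ} (h : IsRunner s m B) {n : ℤ}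
    (h1 : n - s ∈ B) (h2 : n ∉ B) : m n = n := by
  rw [h.mem_iff] at h1 h2
  obtain ⟨q, hq⟩ := cast_eq_iff_exists.1 (h.cast_eq (n : ZMod s))
  simp only [Int.cast_sub, Int.cast_natCast, CharP.cast_eq_zero, sub_zero] at h1
  have : q * s < 1 * s := by omega
  have h3 := lt_of_mul_lt_mul_right this (by positivity)
  have : 0 ≤ q * s := by omega
  have hs : (0 : ℤ) < s := by omega
  have h4 : 0 ≤ q := nonneg_of_mul_nonneg_left this hs
  obtain rfl : q = 0 := by omega
  omega

/-- If `m (c + t)` exceeded `m c + t`, then `m c + t` would lie in `B` while `m c` does not. With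
`t` a natural number this is the `t`-core condition read on the runner. -/
theorem IsRunner.sub_mem_iff {s : ℕ} {m : ZMod s → ℤ} {B : Set ℤ} (h : IsRunner s m B) {t : ℤ} :
    (∀ x ∈ B, x - t ∈ B) ↔ ∀ c : ZMod s, m (c + t) ≤ m c + t := by
  constructor
  · intro hB c
    by_contra hc
    have h1 := hB (m c + t) ((h.mem_iff _).2 (by
      push_cast
      rw [h.cast_eq]
      omega))
    rw [h.mem_iff, add_sub_cancel_right, h.cast_eq] at h1
    omega
  · intro hm x hx
    rw [h.mem_iff] at hx ⊢
    have := hm ((x - t : ℤ) : ZMod s)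
    rw [← Int.cast_add, sub_add_cancel] at this
    omega

/-- Above the cut-off `L`, the shift of `S` by `s` together with `[L, L + s)` is the disjoint union
of `S` and the values of `m`. Suitable `F` then yield the power sums of `m`. -/
theorem IsRunner.sum_shift {s : ℕ} [NeZero s] {m : ZMod s → ℤ} {B : Set ℤ} (h : IsRunner s m B)
    {L : ℤ} (hL : Iio L ⊆ B) {S : Finset ℤ} (hS : ∀ x, x ∈ S ↔ x ∈ B ∧ L ≤ x) (F : ℤ → ℤ) :
    ∑ x ∈ S, F (x + s) + ∑ j ∈ Finset.range s, F (L + j) = ∑ x ∈ S, F x + ∑ c, F (m c) := by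
  have hs : (0 : ℤ) < s := by exact_mod_cast NeZero.pos s
  have hLm : ∀ c, L ≤ m c := fun c => by
    by_contra hc
    have := (h.mem_iff _).1 (hL (not_le.1 hc))
    rw [h.cast_eq] at this
    omega
  have hstep : ∀ x : ℤ, x < m x → x + s ≤ m x := fun x hx => by
    obtain ⟨q, hq⟩ := cast_eq_iff_exists.1 (h.cast_eq (x : ZMod s)).symm
    have h1 : 0 < q := pos_of_mul_pos_left (show 0 < q * s by omega) hs.le
    nlinarith
  have e1 : ∑ x ∈ S, F (x + s) = ∑ x ∈ S.image (· + (s : ℤ)), F x := by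
    rw [Finset.sum_image]
    exact fun a _ b _ hab => by simpa using hab
  have e2 : ∑ j ∈ Finset.range s, F (L + j) = ∑ x ∈ Finset.Ico L (L + s), F x := by
    have : Finset.Ico L (L + s) = (Finset.range s).image fun j : ℕ => L + (j : ℤ) := by
      ext x
      simp only [Finset.mem_Ico, Finset.mem_image, Finset.mem_range]
      constructor
      · intro hx
        exact ⟨(x - L).toNat, by omega, by omega⟩
      · rintro ⟨j, hj, rfl⟩
        omega
    rw [this, Finset.sum_image]
    exact fun a _ b _ hab => by simpa using hab
  have e3 : ∑ c, F (m c) = ∑ x ∈ Finset.univ.image m, F x := by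
    rw [Finset.sum_image]
    intro a _ b _ hab
    rw [← h.cast_eq a, ← h.cast_eq b, hab]
  rw [e1, e2, e3, ← Finset.sum_union, ← Finset.sum_union]
  · congr 1
    ext x
    simp only [Finset.mem_union, Finset.mem_image, hS, Finset.mem_Ico, Finset.mem_univ, true_and,
      h.mem_iff]
    have himg : (∃ c, m c = x) ↔ m x = x :=
      ⟨by rintro ⟨c, rfl⟩; rw [h.cast_eq], fun hx => ⟨_, hx⟩⟩
    have himg2 : (∃ a : ℤ, (a < m a ∧ L ≤ a) ∧ a + (s : ℤ) = x) ↔ x - s < m x ∧ L ≤ x - s := by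
      have hc : ((x - s : ℤ) : ZMod s) = x := by simp
      constructor
      · rintro ⟨a, ha, rfl⟩
        simpa using ha
      · intro ha
        exact ⟨x - s, by rw [hc]; exact ha, by ring⟩
    rw [himg, himg2]
    have h1 := hstep x
    have h2 := hstep (x - s)
    have h3 := hLm x
    have h4 : m x < x → m x ≤ x - s := fun hx => by
      obtain ⟨q, hq⟩ := cast_eq_iff_exists.1 (h.cast_eq (x : ZMod s))
      have h1 : 0 < q := pos_of_mul_pos_left (show 0 < q * s by omega) hs.le
      nlinarith
    simp only [Int.cast_sub, Int.cast_natCast, CharP.cast_eq_zero, sub_zero] at h2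
    omega
  · rw [Finset.disjoint_left]
    rintro x hx hx'
    obtain ⟨c, -, rfl⟩ := Finset.mem_image.1 hx'
    rw [hS, h.mem_iff, h.cast_eq] at hx
    omega
  · rw [Finset.disjoint_left]
    rintro x hx hx'
    obtain ⟨a, ha, rfl⟩ := Finset.mem_image.1 hx
    rw [hS] at ha
    rw [Finset.mem_Ico] at hx'
    omega

/-! ### The size of a core in terms of its runner. -/

theorem two_mul_sum_range (n : ℕ) : 2 * ∑ j ∈ Finset.range n, (j : ℤ) = n * (n - 1) := by
  induction n with
  | zero => simp
  | succ n ih => rw [Finset.sum_range_succ, mul_add, ih]; push_cast; ring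

theorem six_mul_sum_range_sq (n : ℕ) :
    6 * ∑ j ∈ Finset.range n, (j : ℤ) ^ 2 = n * (n - 1) * (2 * n - 1) := by
  induction n with
  | zero => simp
  | succ n ih => rw [Finset.sum_range_succ, mul_add, ih]; push_cast; ring

theorem card_eq_sum_rowLen {lam : YoungDiagram} {N : ℕ} (hN : ∀ k, N ≤ k → lam.rowLen k = 0) :
    lam.card = ∑ k ∈ Finset.range N, lam.rowLen k := by
  rw [YoungDiagram.card, Finset.card_eq_sum_card_fiberwise (f := Prod.fst) (t := Finset.range N)]
  · refine Finset.sum_congr rfl fun k _ => ?_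
    rw [YoungDiagram.rowLen_eq_card]
    rfl
  · rintro ⟨i, j⟩ hx
    have := YoungDiagram.mem_iff_lt_rowLen.1 ((YoungDiagram.mem_cells _).1 (Finset.mem_coe.1 hx))
    rw [Finset.mem_coe, Finset.mem_range]
    by_contra hc
    simp only at hc
    rw [hN i (by omega)] at this
    omega

/-- The part of a beta-set above a low enough bound, with the sums over it. -/
theorem beta_window_sum (r : ℤ) (lam : YoungDiagram) :
    ∃ L0 : ℤ, ∀ L ≤ L0, Iio L ⊆ beta r lam ∧ ∃ S : Finset ℤ,
      (∀ x, x ∈ S ↔ x ∈ beta r lam ∧ L ≤ x) ∧ (S.card : ℤ) = r - L ∧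
      ∑ x ∈ S, x = lam.card + ∑ k ∈ Finset.range (r - L).toNat, (r - (k + 1) : ℤ) := by
  obtain ⟨N, hN⟩ := rowLen_eventually_zero lam
  obtain ⟨L0, hL0⟩ := beta_window r lam
  refine ⟨min L0 (r - N), fun L hL => ?_⟩
  have h1 : L ≤ L0 := hL.trans (min_le_left _ _)
  have h2 : L ≤ r - N := hL.trans (min_le_right _ _)
  have hinj : Function.Injective fun k : ℕ => (lam.rowLen k : ℤ) - ((k : ℤ) + 1) + r :=
    fun a b h => (beta_strictMono r lam).injective (congrArg OrderDual.toDual h)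
  refine ⟨(hL0 L h1).1, (Finset.range (r - L).toNat).image
    fun k : ℕ => (lam.rowLen k : ℤ) - ((k : ℤ) + 1) + r, fun x => ?_, ?_, ?_⟩
  · simp only [Finset.mem_image, Finset.mem_range, beta, Set.mem_range]
    constructor
    · rintro ⟨k, hk, rfl⟩
      exact ⟨⟨k, rfl⟩, by omega⟩
    · rintro ⟨⟨k, rfl⟩, hk⟩
      refine ⟨k, ?_, rfl⟩
      by_contra hc
      rw [hN k (by omega)] at hk
      omega
  · rw [Finset.card_image_of_injective _ hinj, Finset.card_range]
    omega
  · rw [Finset.sum_image fun a _ b _ h => hinj h,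
      card_eq_sum_rowLen (N := (r - L).toNat) fun k hk => hN k (by omega)]
    push_cast
    rw [← Finset.sum_add_distrib]
    exact Finset.sum_congr rfl fun k _ => by ring

theorem IsRunner.two_mul_sum {s : ℕ} [NeZero s] {m : ZMod s → ℤ} {r : ℤ} {lam : YoungDiagram}
    (h : IsRunner s m (beta r lam)) : 2 * ∑ c, m c = 2 * s * r + s * (s - 1) := by
  obtain ⟨L, hL⟩ := beta_window_sum r lam
  obtain ⟨h1, S, hS, hc, -⟩ := hL L le_rfl
  have := h.sum_shift h1 hS id
  simp only [id, Finset.sum_add_distrib, Finset.sum_const, nsmul_eq_mul, hc, Finset.card_range]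
    at this
  have h2 := two_mul_sum_range s
  linear_combination (-2) * this + h2

/-- The size of a core is determined by the sum of the squares of its runner. -/
theorem IsRunner.card_sub_card {s : ℕ} [NeZero s] {m m' : ZMod s → ℤ} {r : ℤ}
    {lam mu : YoungDiagram} (h : IsRunner s m (beta r lam)) (h' : IsRunner s m' (beta r mu)) :
    2 * s * ((lam.card : ℤ) - mu.card) = ∑ c, m c ^ 2 - ∑ c, m' c ^ 2 := by
  obtain ⟨L, hL⟩ := beta_window_sum r lam
  obtain ⟨L', hL'⟩ := beta_window_sum r mu
  have key : ∀ {m : ZMod s → ℤ} {lam : YoungDiagram} (_ : IsRunner s m (beta r lam))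
      (M : ℤ) (_ : Iio M ⊆ beta r lam) (S : Finset ℤ)
      (_ : ∀ x, x ∈ S ↔ x ∈ beta r lam ∧ M ≤ x)
      (_ : ∑ x ∈ S, x = lam.card + ∑ k ∈ Finset.range (r - M).toNat, (r - (k + 1) : ℤ)),
      2 * s * (lam.card + ∑ k ∈ Finset.range (r - M).toNat, (r - (k + 1) : ℤ)) +
        ∑ j ∈ Finset.range s, (((M + j) ^ 2 : ℤ) - s * (M + j))
        = ∑ c, m c ^ 2 - s * ∑ c, m c := by
    intro m lam h M hM S hS hsum
    -- For `F x = x ^ 2 - s * x` the difference `F (x + s) - F x` is `2 * s * x`, so the sum over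
    -- `S`, and with it the size, appears linearly.
    have := h.sum_shift hM hS fun x => x ^ 2 - s * x
    rw [← hsum, Finset.mul_sum, Finset.mul_sum, ← Finset.sum_sub_distrib (f := fun c => m c ^ 2)]
    have e : ∑ x ∈ S, ((x + s) ^ 2 - s * (x + s) : ℤ)
        = ∑ x ∈ S, 2 * s * x + ∑ x ∈ S, (x ^ 2 - s * x : ℤ) := by
      rw [← Finset.sum_add_distrib]
      exact Finset.sum_congr rfl fun x _ => by ring
    linear_combination this - e
  -- A common cut-off makes the terms depending only on the window cancel.
  obtain ⟨h1, S, hS, -, hsum⟩ := hL (min L L') (min_le_left _ _)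
  obtain ⟨h1', S', hS', -, hsum'⟩ := hL' (min L L') (min_le_right _ _)
  have k1 := key h _ h1 S hS hsum
  have k2 := key h' _ h1' S' hS' hsum'
  have e1 := h.two_mul_sum
  have e2 := h'.two_mul_sum
  have e3 : ∑ c, m c = ∑ c, m' c := by linarith
  rw [e3] at k1
  linear_combination k1 - k2

/-! ### Runners in arithmetic progression -/

theorem sum_zmod_eq_sum_range {s t : ℕ} [NeZero s] (hst : s.Coprime t) (c : ZMod s)
    (f : ZMod s → ℤ) : ∑ d, f d = ∑ j ∈ Finset.range s, f (c + j * t) := by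
  have hinj : Set.InjOn (fun j : ℕ => c + (j : ZMod s) * t) (Finset.range s) := by
    intro a ha b hb hab
    have h1 := natCast_cancel hst (add_left_cancel hab)
    rw [Finset.coe_range, mem_Iio] at ha hb
    rw [ZMod.natCast_eq_natCast_iff'] at h1
    rwa [Nat.mod_eq_of_lt ha, Nat.mod_eq_of_lt hb] at h1
  rw [← Finset.sum_image (f := f) hinj]
  congr 1
  exact (Finset.eq_univ_of_card _ (by
    rw [Finset.card_image_of_injOn hinj, Finset.card_range, ZMod.card])).symm

/-- The values of `m` are in arithmetic progression along the steps of length `t` from `c`. -/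
def IsProgression {s : ℕ} (t : ℕ) (m : ZMod s → ℤ) (c : ZMod s) : Prop :=
  ∀ j : ℕ, j < s → m (c + j * t) = m c + j * t

theorem IsProgression.two_mul_sum {s t : ℕ} [NeZero s] (hst : s.Coprime t) {m : ZMod s → ℤ}
    {c : ZMod s} (h : IsProgression t m c) :
    2 * ∑ d, m d = 2 * s * m c + t * (s * (s - 1)) := by
  rw [sum_zmod_eq_sum_range hst c, Finset.sum_congr rfl fun j hj => h j (Finset.mem_range.1 hj),
    Finset.sum_add_distrib, ← Finset.sum_mul, Finset.sum_const, Finset.card_range, nsmul_eq_mul]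
  linear_combination (t : ℤ) * two_mul_sum_range s

theorem two_mul_circ {s t : ℕ} (hst : s.Coprime t) : 2 * circ s t = ((s : ℤ) - 1) * (t - 1) := by
  apply Int.mul_ediv_cancel'
  rcases Nat.even_or_odd s with h | h
  · have h' : Odd t := by
      by_contra hc
      have h2 := Nat.eq_one_of_dvd_coprimes hst h.two_dvd (Nat.not_odd_iff_even.1 hc).two_dvd
      omega
    obtain ⟨k, rfl⟩ := h'
    exact Dvd.dvd.mul_left ⟨(k : ℤ), by push_cast; ring⟩ _
  · obtain ⟨k, rfl⟩ := h
    exact Dvd.dvd.mul_right ⟨(k : ℤ), by push_cast; ring⟩ _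

/-- The sum is the one of a runner of a beta-set with `r = 0`, and it leaves one possible starting
value. The same shift by `circ s t` appears in the level `t` action. -/
theorem IsProgression.apply_eq {s t : ℕ} [NeZero s] (hst : s.Coprime t) {m : ZMod s → ℤ}
    {c : ZMod s} (h : IsProgression t m c) (hsum : 2 * ∑ d, m d = s * (s - 1)) :
    m c = - circ s t := by
  have h1 := h.two_mul_sum hst
  have h2 := two_mul_circ hst
  have hs : (s : ℤ) ≠ 0 := by exact_mod_cast NeZero.ne s
  have : (2 * s : ℤ) * (m c) = 2 * s * (- circ s t) := by
    linear_combination hsum - h1 + (s : ℤ) * h2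
  exact mul_left_cancel₀ (by positivity) this

theorem IsProgression.ext {s t : ℕ} [NeZero s] (hst : s.Coprime t) {m m' : ZMod s → ℤ}
    {c c' : ZMod s} (h : IsProgression t m c) (h' : IsProgression t m' c')
    (hsum : 2 * ∑ d, m d = s * (s - 1)) (hsum' : 2 * ∑ d, m' d = s * (s - 1))
    (hm : ∀ d, (m d : ZMod s) = d) (hm' : ∀ d, (m' d : ZMod s) = d) : m = m' := by
  have e := h.apply_eq hst hsum
  have e' := h'.apply_eq hst hsum'
  obtain rfl : c = c' := by rw [← hm c, ← hm' c', e, e']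
  -- A vanishing sum of squares carries the equality from the classes `c + j * t` to all classes,
  -- through the reindexing lemma.
  have h0 : ∑ d, (m d - m' d) ^ 2 = 0 := by
    rw [sum_zmod_eq_sum_range hst c]
    refine Finset.sum_eq_zero fun j hj => ?_
    rw [h j (Finset.mem_range.1 hj), h' j (Finset.mem_range.1 hj), e, e', sub_self]
    rfl
  funext d
  have := (Finset.sum_eq_zero_iff_of_nonneg fun d _ => sq_nonneg _).1 h0 d (Finset.mem_univ d)
  exact sub_eq_zero.1 (pow_eq_zero_iff two_ne_zero |>.1 this)

theorem IsProgression.sum_sq {s t : ℕ} [NeZero s] (hst : s.Coprime t) {m : ZMod s → ℤ}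
    {c : ZMod s} (h : IsProgression t m c) :
    6 * (2 * s * ∑ d, m d ^ 2 - 2 * (∑ d, m d) ^ 2)
      = 6 * ∑ j ∈ Finset.range s, (s * (j * (s - j) * t ^ 2) : ℤ) := by
  have e1 := two_mul_sum_range s
  have e2 := six_mul_sum_range_sq s
  have e3 := h.two_mul_sum hst
  have e4 : ∑ d, m d ^ 2 = s * m c ^ 2 + 2 * m c * t * ∑ j ∈ Finset.range s, (j : ℤ)
      + t ^ 2 * ∑ j ∈ Finset.range s, (j : ℤ) ^ 2 := by
    have : (s : ℤ) * m c ^ 2 = ∑ _j ∈ Finset.range s, m c ^ 2 := by simp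
    rw [sum_zmod_eq_sum_range hst c, Finset.mul_sum, Finset.mul_sum, this,
      ← Finset.sum_add_distrib, ← Finset.sum_add_distrib]
    refine Finset.sum_congr rfl fun j hj => ?_
    rw [h j (Finset.mem_range.1 hj)]
    ring
  have e5 : ∑ j ∈ Finset.range s, (s * (j * (s - j) * t ^ 2) : ℤ)
      = s ^ 2 * t ^ 2 * ∑ j ∈ Finset.range s, (j : ℤ)
        - s * t ^ 2 * ∑ j ∈ Finset.range s, (j : ℤ) ^ 2 := by
    rw [Finset.mul_sum, Finset.mul_sum, ← Finset.sum_sub_distrib]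
    exact Finset.sum_congr rfl fun j _ => by ring
  have e6 : (2 * ∑ d, m d) ^ 2 = (2 * s * m c + t * (s * (s - 1))) ^ 2 := by rw [e3]
  rw [e4, e5]
  linear_combination (-3) * e6 + (12 * s * m c * t - 3 * s ^ 2 * t ^ 2) * e1
    + (3 * s * t ^ 2) * e2

/-! ### The quadratic bound for simultaneous cores and its equality case. -/

theorem add_mul_le {s t : ℕ} {m : ZMod s → ℤ} (hm : ∀ c, m (c + t) ≤ m c + t) (c : ZMod s)
    (j : ℕ) : m (c + j * t) ≤ m c + j * t := by
  induction j with
  | zero => simp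
  | succ j ih =>
    have := hm (c + j * t)
    push_cast
    rw [show c + ((j : ZMod s) + 1) * t = c + j * t + t by ring]
    linarith

/-- From `c + j * t`, another `s - j` steps of length `t` close the cycle at `c`. -/
theorem le_add_mul {s t : ℕ} {m : ZMod s → ℤ} (hm : ∀ c, m (c + t) ≤ m c + t) (c : ZMod s)
    {j : ℕ} (hj : j ≤ s) : m c ≤ m (c + j * t) + (s - j) * t := by
  have := add_mul_le hm (c + j * t) (s - j)
  rw [Nat.cast_sub hj, Nat.cast_sub hj] at this
  rwa [show c + (j : ZMod s) * t + (((s : ℕ) : ZMod s) - j) * t = c by simp] at this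

theorem sum_sum_sub_sq {s t : ℕ} [NeZero s] (hst : s.Coprime t) (m : ZMod s → ℤ) :
    ∑ j ∈ Finset.range s, ∑ c, (m (c + j * t) - m c) ^ 2
      = 2 * s * ∑ d, m d ^ 2 - 2 * (∑ d, m d) ^ 2 := by
  rw [Finset.sum_comm]
  have e : ∀ c, ∑ j ∈ Finset.range s, (m (c + j * t) - m c) ^ 2
      = ∑ d, m d ^ 2 - 2 * m c * ∑ d, m d + s * m c ^ 2 := by
    intro c
    rw [← sum_zmod_eq_sum_range hst c fun d => (m d - m c) ^ 2, Finset.mul_sum,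
      ← Finset.sum_sub_distrib]
    have : (s : ℤ) * m c ^ 2 = ∑ _d : ZMod s, m c ^ 2 := by simp [ZMod.card]
    rw [this, ← Finset.sum_add_distrib]
    exact Finset.sum_congr rfl fun d _ => by ring
  simp only [e]
  rw [Finset.sum_add_distrib, Finset.sum_sub_distrib, ← Finset.sum_mul, ← Finset.mul_sum,
    ← Finset.mul_sum, Finset.sum_const, Finset.card_univ, ZMod.card, nsmul_eq_mul]
  ring

/-- With `d = m (c + j * t) - m c`, each product is `j * (s - j) * t ^ 2 - d ^ 2 + (2 * j - s) * t *
d`, and the linear term sums to zero over the classes. -/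
theorem sum_mul_eq {s t : ℕ} [NeZero s] (m : ZMod s → ℤ) (j : ℕ) :
    ∑ c, (m (c + j * t) - m c + (s - j) * t) * (j * t - (m (c + j * t) - m c))
      = s * (j * (s - j) * t ^ 2) - ∑ c, (m (c + j * t) - m c) ^ 2 := by
  have h0 : ∑ c, (m (c + j * t) - m c) = 0 := by
    rw [Finset.sum_sub_distrib, sub_eq_zero]
    exact Equiv.sum_comp (Equiv.addRight ((j : ZMod s) * t)) m
  have : (s * (j * (s - j) * t ^ 2) : ℤ)
      = ∑ _c : ZMod s, (j * (s - j) * t ^ 2 : ℤ) := by simp [ZMod.card]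
  rw [this, ← Finset.sum_sub_distrib, ← sub_eq_zero, ← Finset.sum_sub_distrib]
  calc _ = ∑ c, ((2 * j - s) * t : ℤ) * (m (c + j * t) - m c) :=
        Finset.sum_congr rfl fun c _ => by ring
    _ = 0 := by rw [← Finset.mul_sum, h0, mul_zero]

/-- Each difference `m (c + j * t) - m c` lies in `[-(s - j) * t, j * t]`, so both factors in
`sum_mul_eq` are non-negative. -/
theorem sum_sq_le {s t : ℕ} [NeZero s] (hst : s.Coprime t) {m : ZMod s → ℤ}
    (hm : ∀ c, m (c + t) ≤ m c + t) :
    2 * s * ∑ d, m d ^ 2 - 2 * (∑ d, m d) ^ 2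
      ≤ ∑ j ∈ Finset.range s, (s * (j * (s - j) * t ^ 2) : ℤ) := by
  rw [← sum_sum_sub_sq hst]
  refine Finset.sum_le_sum fun j hj => ?_
  rw [← sub_nonneg, ← sum_mul_eq]
  refine Finset.sum_nonneg fun c _ => mul_nonneg ?_ ?_
  · have := le_add_mul hm c (Finset.mem_range.1 hj).le
    linarith
  · have := add_mul_le hm c j
    linarith

/-- Equality makes every product vanish, and `j = 1` suffices: each step is `+t` or `-(s - 1) * t`.
Not all are `+t`, as the steps sum to zero; the progression starts right after a drop. -/
theorem exists_isProgression {s t : ℕ} [NeZero s] (hs : 2 ≤ s) (ht : 0 < t) (hst : s.Coprime t)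
    {m : ZMod s → ℤ} (hm : ∀ c, m (c + t) ≤ m c + t)
    (heq : 2 * s * ∑ d, m d ^ 2 - 2 * (∑ d, m d) ^ 2
      = ∑ j ∈ Finset.range s, (s * (j * (s - j) * t ^ 2) : ℤ)) :
    ∃ c, IsProgression t m c := by
  have hnn : ∀ j ∈ Finset.range s, ∀ c ∈ Finset.univ,
      0 ≤ (m (c + j * t) - m c + (s - j) * t) * (j * t - (m (c + j * t) - m c)) := by
    intro j hj c _
    have h1 := le_add_mul hm c (Finset.mem_range.1 hj).le
    have h2 := add_mul_le hm c j
    exact mul_nonneg (by linarith) (by linarith)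
  have h0 : ∑ j ∈ Finset.range s, ∑ c,
      (m (c + j * t) - m c + (s - j) * t) * (j * t - (m (c + j * t) - m c)) = 0 := by
    simp only [sum_mul_eq]
    rw [Finset.sum_sub_distrib, sum_sum_sub_sq hst, heq, sub_self]
  have h1 := (Finset.sum_eq_zero_iff_of_nonneg fun j hj => Finset.sum_nonneg (hnn j hj)).1 h0 1
    (Finset.mem_range.2 hs)
  have h2 := (Finset.sum_eq_zero_iff_of_nonneg (hnn 1 (Finset.mem_range.2 hs))).1 h1
  simp only [Finset.mem_univ, true_implies, Nat.cast_one, one_mul] at h2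
  obtain ⟨c, hc⟩ : ∃ c, m (c + t) - m c + (s - 1) * t = 0 := by
    by_contra! hne
    have h3 : ∀ c, m (c + t) = m c + t := fun c => by
      have := (mul_eq_zero.1 (h2 c)).resolve_left (hne c)
      linarith
    have h4 : ∑ c, m (c + t) = ∑ c, m c := Equiv.sum_comp (Equiv.addRight (t : ZMod s)) m
    simp only [h3, Finset.sum_add_distrib, Finset.sum_const, Finset.card_univ, ZMod.card,
      nsmul_eq_mul, add_eq_left, mul_eq_zero, Nat.cast_eq_zero] at h4
    omega
  -- The `s - 1` steps from `c + t` back to `c` must recover `(s - 1) * t` while each gains at most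
  -- `t`, so each gains exactly `t`.
  refine ⟨c + t, fun j hj => le_antisymm (add_mul_le hm _ _) ?_⟩
  have h5 := add_mul_le hm (c + t + j * t) (s - 1 - j)
  rw [Nat.cast_sub (by omega), Nat.cast_sub (by omega), Nat.cast_sub (by omega),
    Nat.cast_sub (by omega), show c + t + (j : ZMod s) * t
      + (((s : ℕ) : ZMod s) - ((1 : ℕ) : ZMod s) - j) * t = c by push_cast; simp; ring] at h5
  push_cast at h5
  linarith

/-! ### Transitivity of the level one action on cores -/

theorem circ_one (s : ℕ) : circ s 1 = 0 := by simp [circ]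

theorem circ_comm (s t : ℕ) : circ s t = circ t s := by rw [circ, circ, mul_comm]

theorem genFun_one (s : ℕ) (i : ZMod s) (n : ℤ) :
    genFun s 1 i n = if (n : ZMod s) = i - 1 then n + 1 else if (n : ZMod s) = i then n - 1
      else n := by
  simp [genFun, circ_one]

theorem beta_bot : beta 0 (⊥ : YoungDiagram) = Iio 0 := by
  ext x
  have h0 : ∀ k, (⊥ : YoungDiagram).rowLen k = 0 := fun k => by
    by_contra h
    exact YoungDiagram.notMem_bot _ (YoungDiagram.mem_iff_lt_rowLen.2 (Nat.pos_of_ne_zero h))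
  rw [mem_beta_zero, mem_Iio]
  constructor
  · rintro ⟨k, hk⟩
    rw [h0] at hk
    omega
  · intro hx
    exact ⟨(-x - 1).toNat, by rw [h0]; omega⟩

/-- A runner on which no generator of `W s` decreases the sum of squares is that of the empty
partition. -/
theorem setOf_lt_eq_Iio {s : ℕ} [NeZero s] {m : ZMod s → ℤ}
    (hcast : ∀ c, (m c : ZMod s) = c) (hsum : 2 * ∑ c, m c = s * (s - 1))
    (hm : ∀ c, m (c + 1) ≤ m c + 1) : {n : ℤ | n < m n} = Iio 0 := by
  have hs : (0 : ℤ) < s := by exact_mod_cast NeZero.pos s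
  -- Starting from the minimum, `m (c + j)` lies between `m c` and `m c + j` and is congruent to `m
  -- c + j` modulo `s`; as `j < s`, it equals `m c + j`.
  obtain ⟨c, hc⟩ := Finite.exists_min m
  have hprog : IsProgression 1 m c := by
    intro j hj
    have h1 := add_mul_le (t := 1) (by simpa using hm) c j
    have h2 := hc (c + j * (1 : ℕ))
    obtain ⟨q, hq⟩ := cast_eq_iff_exists.1
      (show ((m (c + j * (1 : ℕ)) : ℤ) : ZMod s) = ((m c + j : ℤ) : ZMod s) by
        push_cast
        rw [hcast, hcast]
        ring)
    push_cast at h1 h2 hq ⊢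
    have h3 : q < 1 := by
      by_contra h3
      nlinarith
    have h4 : 0 ≤ q := by
      by_contra h4
      nlinarith
    obtain rfl : q = 0 := by omega
    omega
  have h0 := hprog.apply_eq s.coprime_one_right hsum
  rw [circ_one, neg_zero] at h0
  obtain rfl : c = 0 := by rw [← hcast c, h0, Int.cast_zero]
  ext n
  have hmod : (((n % s).toNat : ℕ) : ℤ) = n % s :=
    Int.toNat_of_nonneg (Int.emod_nonneg _ hs.ne')
  have hlt := Int.emod_lt_of_pos n hs
  have h1 := hprog (n % s).toNat (by omega)
  have h2 : (((n % s).toNat : ℕ) : ZMod s) = n := by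
    rw [← Int.cast_natCast, hmod]
    simp
  rw [h2, h0, hmod] at h1
  simp only [Nat.cast_one, mul_one, zero_add] at h1
  rw [mem_ofPred_eq, h1, mem_Iio]
  have h3 := Int.mul_ediv_add_emod n s
  constructor
  · intro h
    by_contra hn
    have h4 := Int.ediv_nonneg (not_lt.1 hn) hs.le
    nlinarith
  · intro h
    have := Int.emod_nonneg n hs.ne'
    omega

/-- Descent on the sum of squares: where `m (c + 1) > m c + 1`, the generator indexed by `c + 1`
exchanges the two runners and lowers the sum by `2 * (m (c + 1) - m c - 1)`. When no such `c`
remains, the partition is empty. -/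
theorem exists_intAction_image {s : ℕ} [NeZero s] (hs : 2 ≤ s) (m : ZMod s → ℤ)
    (hcast : ∀ c, (m c : ZMod s) = c) (hsum : 2 * ∑ c, m c = s * (s - 1)) :
    ∃ w : W s, intAction hs s.coprime_one_right w '' Iio 0 = {n : ℤ | n < m n} := by
  induction hN : (∑ c, m c ^ 2).toNat using Nat.strong_induction_on generalizing m with
  | _ N ih =>
    by_cases hm : ∀ c, m (c + 1) ≤ m c + 1
    · exact ⟨1, by rw [setOf_lt_eq_Iio hcast hsum hm]; simp⟩
    push Not at hm
    obtain ⟨c, hc⟩ := hm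
    have hne : c + 1 ≠ c := fun h => by
      rw [h] at hc
      omega
    -- The new runner is `m + δ` composed with a transposition, so that its power sums can be
    -- reindexed to those of `m + δ`.
    let δ : ZMod s → ℤ := fun d => (if d = c then 1 else 0) - (if d = c + 1 then 1 else 0)
    let m' : ZMod s → ℤ := fun d => m (Equiv.swap c (c + 1) d) + δ (Equiv.swap c (c + 1) d)
    have hmc : m' c = m (c + 1) - 1 := by simp [m', δ, hne]; ring
    have hmc' : m' (c + 1) = m c + 1 := by simp [m', δ, hne.symm]
    have hmd : ∀ d, d ≠ c → d ≠ c + 1 → m' d = m d := fun d h1 h2 => by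
      simp [m', δ, Equiv.swap_apply_of_ne_of_ne h1 h2, h1, h2]
    have hcast' : ∀ d, (m' d : ZMod s) = d := by
      intro d
      by_cases h1 : d = c
      · rw [h1, hmc, Int.cast_sub, hcast]
        simp
      by_cases h2 : d = c + 1
      · rw [h2, hmc', Int.cast_add, hcast]
        simp
      · rw [hmd d h1 h2, hcast]
    have hsum1 : ∑ d, m' d = ∑ d, m d := by
      rw [Equiv.sum_comp (Equiv.swap c (c + 1)) fun d => m d + δ d]
      simp [δ, Finset.sum_add_distrib]
    have hsq : ∑ d, m' d ^ 2 = ∑ d, m d ^ 2 + 2 * (m c + 1 - m (c + 1)) := by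
      have e : ∀ d, (m d + δ d) ^ 2 = m d ^ 2 + (if d = c then 2 * m d + 1 else 0)
          + (if d = c + 1 then - 2 * m d + 1 else 0) := by
        intro d
        by_cases h1 : d = c
        · subst h1
          simp only [δ, if_pos, if_neg hne.symm]
          ring
        by_cases h2 : d = c + 1
        · simp only [δ, if_pos h2, if_neg h1]
          ring
        · simp [δ, h1, h2]
      rw [Equiv.sum_comp (Equiv.swap c (c + 1)) fun d => (m d + δ d) ^ 2]
      simp only [e, Finset.sum_add_distrib, Finset.sum_ite_eq', Finset.mem_univ, if_true]
      ring
    have hnn : 0 ≤ ∑ d, m' d ^ 2 := Finset.sum_nonneg fun d _ => sq_nonneg _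
    obtain ⟨w, hw⟩ := ih _ (by omega) m' hcast' (by rw [hsum1, hsum]) rfl
    refine ⟨(affineMatrix s).simple (c + 1) * w, ?_⟩
    rw [map_mul, Equiv.Perm.coe_mul, Set.image_comp, hw, intAction_simple]
    have hinv := genFun_invol hs s.coprime_one_right (c + 1)
    ext n
    have : n ∈ (genPerm hs s.coprime_one_right (c + 1)) '' {n : ℤ | n < m' n}
        ↔ genFun s 1 (c + 1) n ∈ {n : ℤ | n < m' n} := by
      constructor
      · rintro ⟨x, hx, rfl⟩
        show genFun s 1 (c + 1) (genFun s 1 (c + 1) x) ∈ _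
        rwa [hinv]
      · intro h
        exact ⟨_, h, hinv n⟩
    rw [this, genFun_one, add_sub_cancel_right]
    simp only [mem_ofPred_eq]
    split_ifs with h1 h2
    · push_cast
      rw [h1, hmc']
      omega
    · push_cast
      rw [h2, add_sub_cancel_right, hmc]
      omega
    · rw [hmd _ h1 h2]

theorem intAction_sub {s : ℕ} (hs : 2 ≤ s) (w : W s) (x : ℤ) :
    intAction hs s.coprime_one_right w (x - s) = intAction hs s.coprime_one_right w x - s := by
  induction w using (affineMatrix s).toCoxeterSystem.simple_induction generalizing x with
  | one => simp
  | mul w w' h h' => simp only [map_mul, Equiv.Perm.mul_apply, h', h]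
  | simple i =>
    rw [CoxeterMatrix.toCoxeterSystem_simple, intAction_simple]
    show genFun s 1 i (x - s) = genFun s 1 i x - s
    rw [genFun_one, genFun_one]
    simp only [Int.cast_sub, Int.cast_natCast, CharP.cast_eq_zero, sub_zero]
    split_ifs <;> ring

theorem intAction_add_mul {s : ℕ} (hs : 2 ≤ s) (w : W s) (x q : ℤ) :
    intAction hs s.coprime_one_right w (x + q * s)
      = intAction hs s.coprime_one_right w x + q * s := by
  induction q using Int.induction_on with
  | zero => simp
  | succ q ih =>
    have := intAction_sub hs w (x + (q + 1) * s)
    rw [show x + ((q : ℤ) + 1) * s - s = x + q * s by ring, ih] at this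
    linarith
  | pred q ih =>
    have := intAction_sub hs w (x + (-q) * s)
    rw [show x + (-(q : ℤ)) * s - s = x + (-q - 1) * s by ring, ih] at this
    linarith

/-- The `s`-cores are the orbit of the empty partition under the level one action. -/
theorem mem_cores_iff_exists_action {s : ℕ} (hs : 2 ≤ s) {lam : YoungDiagram} :
    lam ∈ cores s ↔ ∃ w : W s, action hs s.coprime_one_right w ⊥ = lam := by
  have : NeZero s := ⟨by omega⟩
  rw [mem_cores_iff (by omega)]
  constructor
  · intro h
    obtain ⟨m, hm⟩ := exists_isRunner h
    have hsum := hm.two_mul_sum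
    obtain ⟨w, hw⟩ := exists_intAction_image hs m hm.cast_eq (by linarith)
    refine ⟨w, (beta_inj (r := 0) (r' := 0) ?_).2⟩
    rw [beta_action, beta_bot, hw]
    ext n
    exact (hm.mem_iff n).symm
  · rintro ⟨w, rfl⟩
    rw [beta_action, beta_bot]
    rintro _ ⟨x, hx, rfl⟩
    exact ⟨x - s, by rw [mem_Iio] at hx ⊢; omega, intAction_sub hs w x⟩

/-! ### The partition `kappa s t` -/

/-- The sum of the two floors is unchanged under `(a + t * q, k - s * q)`, hence depends only on the
integer represented. -/
theorem exists_combination_iff {s t : ℕ} (hs : 0 < s) (ht : 0 < t) (hst : s.Coprime t) (a k : ℤ) :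
    (∃ a' k' : ℕ, a * s + k * t = (a' : ℤ) * s + (k' : ℤ) * t) ↔ 0 ≤ a / t + k / s := by
  have hs' : (0 : ℤ) < s := by exact_mod_cast hs
  have ht' : (0 : ℤ) < t := by exact_mod_cast ht
  constructor
  · rintro ⟨a', k', h⟩
    have hd : (t : ℤ) ∣ s * (a - a') := ⟨k' - k, by linarith⟩
    obtain ⟨q, hq⟩ := (Nat.isCoprime_iff_coprime.2 hst.symm).dvd_of_dvd_mul_left hd
    have hk : k = k' + s * (-q) := by
      apply mul_right_cancel₀ ht'.ne'
      linear_combination h - s * hq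
    rw [hk, show a = a' + t * q by linarith, Int.add_mul_ediv_left _ _ ht'.ne',
      Int.add_mul_ediv_left _ _ hs'.ne']
    have h1 : 0 ≤ (a' : ℤ) / t := Int.ediv_nonneg (by positivity) ht'.le
    have h2 : 0 ≤ (k' : ℤ) / s := Int.ediv_nonneg (by positivity) hs'.le
    linarith
  · intro h
    have h1 := Int.mul_ediv_add_emod a t
    have h2 := Int.mul_ediv_add_emod k s
    have h3 := Int.emod_nonneg a ht'.ne'
    have h4 := Int.emod_nonneg k hs'.ne'
    -- Reduce `a` modulo `t` and carry its quotient over to `k`.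
    refine ⟨(a % t).toNat, (k % s + s * (a / t + k / s)).toNat, ?_⟩
    rw [Int.toNat_of_nonneg h3, Int.toNat_of_nonneg (by positivity)]
    linear_combination (-(s : ℤ)) * h1 - t * h2

theorem exists_eq_add_mul {s t : ℕ} (hst : s.Coprime t) (n : ℤ) :
    ∃ a k : ℤ, n = a * s + k * t := by
  obtain ⟨u, v, huv⟩ := Nat.isCoprime_iff_coprime.2 hst
  exact ⟨n * u, n * v, by linear_combination (-n) * huv⟩

theorem kappa_comm (s t : ℕ) : kappa s t = kappa t s := by
  unfold kappa
  congr 1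
  ext n
  rw [mem_ofPred_eq, mem_ofPred_eq, not_iff_not, exists_comm]
  simp only [add_comm]

theorem exists_beta_kappa {s t : ℕ} (hs : 0 < s) (ht : 0 < t) (hst : s.Coprime t) :
    ∃ r, beta r (kappa s t) = {n : ℤ | ¬ ∃ a b : ℕ, n = (a : ℤ) * s + (b : ℤ) * t} := by
  have hs' : (0 : ℤ) < s := by exact_mod_cast hs
  have ht' : (0 : ℤ) < t := by exact_mod_cast ht
  apply exists_beta_ofBeta
  -- Floors summing to at most `-1` give `n < s * t * (-1 + 2)`.
  · refine ⟨t * s, fun n hn => ?_⟩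
    obtain ⟨a, k, rfl⟩ := exists_eq_add_mul hst n
    rw [mem_ofPred_eq, exists_combination_iff hs ht hst, not_le] at hn
    have h1 := Int.mul_ediv_add_emod a t
    have h2 := Int.mul_ediv_add_emod k s
    have h3 := Int.emod_lt_of_pos a ht'
    have h4 := Int.emod_lt_of_pos k hs'
    have h5 : (s * t : ℤ) * (a / t + k / s) ≤ (s * t) * (-1) :=
      mul_le_mul_of_nonneg_left (by omega) (by positivity)
    nlinarith
  · refine ⟨0, fun n hn => ?_⟩
    rw [mem_compl_iff, mem_ofPred_eq, not_not] at hn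
    obtain ⟨a, b, rfl⟩ := hn
    positivity

theorem combination_sub_mem {s t : ℕ} {n : ℤ}
    (hn : n ∈ {n : ℤ | ¬ ∃ a b : ℕ, n = (a : ℤ) * s + (b : ℤ) * t}) :
    n - s ∈ {n : ℤ | ¬ ∃ a b : ℕ, n = (a : ℤ) * s + (b : ℤ) * t} := by
  rintro ⟨a, b, h⟩
  exact hn ⟨a + 1, b, by push_cast; linarith⟩

/-- For `j < s` the integer `j * t` is a combination but `j * t - s` is not, so `j * t` is the least
gap in its class. -/
theorem IsRunner.isProgression_combination {s t : ℕ} (hs : 0 < s) (ht : 0 < t)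
    (hst : s.Coprime t) {m : ZMod s → ℤ}
    (h : IsRunner s m {n : ℤ | ¬ ∃ a b : ℕ, n = (a : ℤ) * s + (b : ℤ) * t}) :
    m 0 = 0 ∧ IsProgression t m 0 := by
  have key : ∀ j : ℕ, j < s → m (j * t) = j * t := by
    intro j hj
    have := h.eq_of_lt (n := j * t) ?_ ?_
    · simpa using this
    · have e : (j : ℤ) * t - s = (-1) * s + j * t := by ring
      rw [e, mem_ofPred_eq, exists_combination_iff hs ht hst, not_le,
        Int.ediv_eq_zero_of_lt (a := j) (by positivity) (by exact_mod_cast hj)]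
      have : (-1 : ℤ) / t = -1 := Int.ediv_eq_neg_one_of_neg_of_le (by norm_num) (by omega)
      omega
    · rw [mem_ofPred_eq, not_not]
      exact ⟨0, j, by simp⟩
  have h0 : m 0 = 0 := by simpa using key 0 hs
  exact ⟨h0, fun j hj => by rw [zero_add, key j hj, h0, zero_add]⟩

/-- The index is found by computing the sum of the runner twice: from the beta-set, and from the
progression `0, t, ..., (s - 1) * t`. -/
theorem beta_circ_kappa {s t : ℕ} (hs : 0 < s) (ht : 0 < t) (hst : s.Coprime t) :
    beta (circ s t) (kappa s t)
      = {n : ℤ | ¬ ∃ a b : ℕ, n = (a : ℤ) * s + (b : ℤ) * t} := by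
  have : NeZero s := ⟨hs.ne'⟩
  obtain ⟨r, hr⟩ := exists_beta_kappa hs ht hst
  obtain ⟨m, hm⟩ := exists_isRunner (s := s) (r := r) (lam := kappa s t) (by
    rw [hr]
    exact fun n => combination_sub_mem)
  have h1 := hm.two_mul_sum
  rw [hr] at hm
  obtain ⟨h0, hp⟩ := hm.isProgression_combination hs ht hst
  have h2 := hp.two_mul_sum hst
  have h3 := two_mul_circ hst
  have : (2 * s : ℤ) * r = 2 * s * circ s t := by
    rw [h0] at h2
    linear_combination h2 - h1 - (s : ℤ) * h3
  have hs' : (2 * s : ℤ) ≠ 0 := by positivity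
  rw [← mul_left_cancel₀ hs' this, hr]

/-- The beta-set of `kappa s t` in the coordinates `(a, k)` of `a * s + k * t - circ s t`. -/
theorem mem_beta_kappa {s t : ℕ} (hs : 0 < s) (ht : 0 < t) (hst : s.Coprime t) (a k : ℤ) :
    a * s + k * t - circ s t ∈ beta 0 (kappa s t) ↔ a / t + k / s < 0 := by
  rw [← mem_beta_iff, beta_circ_kappa hs ht hst, mem_ofPred_eq, exists_combination_iff hs ht hst,
    not_le]

theorem kappa_mem_cores {s t : ℕ} (hs : 0 < s) (ht : 0 < t) (hst : s.Coprime t) :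
    kappa s t ∈ cores s := by
  rw [mem_cores_iff hs]
  intro x hx
  rw [show x = x + circ s t - circ s t by ring, ← mem_beta_iff, beta_circ_kappa hs ht hst] at hx
  rw [show x - s = x + circ s t - s - circ s t by ring, ← mem_beta_iff, beta_circ_kappa hs ht hst]
  exact combination_sub_mem hx

/-- The runner of `kappa s t` is an arithmetic progression. -/
theorem exists_isRunner_kappa {s t : ℕ} [NeZero s] (ht : 0 < t) (hst : s.Coprime t) :
    ∃ (m : ZMod s → ℤ) (c : ZMod s), IsRunner s m (beta 0 (kappa s t)) ∧ IsProgression t m c := by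
  have hs : 0 < s := NeZero.pos s
  obtain ⟨m, hm⟩ := exists_isRunner ((mem_cores_iff hs).1 (kappa_mem_cores hs ht hst))
  refine ⟨m, ((-circ s t : ℤ) : ZMod s), hm, ?_⟩
  have hm' : IsRunner s (fun c => m (c - (circ s t : ℤ)) + circ s t)
      {n : ℤ | ¬ ∃ a b : ℕ, n = (a : ℤ) * s + (b : ℤ) * t} := by
    refine ⟨fun c => by push_cast; rw [hm.cast_eq]; ring, fun n => ?_⟩
    rw [← beta_circ_kappa hs ht hst, mem_beta_iff, hm.mem_iff, sub_lt_iff_lt_add]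
    push_cast
    rfl
  obtain ⟨-, hp⟩ := hm'.isProgression_combination hs ht hst
  intro j hj
  have := hp j hj
  simp only [zero_add, zero_sub] at this
  rw [Int.cast_neg, neg_add_eq_sub]
  linarith

/-- Sizes are compared through sums of squares of runners modulo `s`. The runner of `kappa s t`
attains the bound, and any other attaining it is a progression with the same sum, hence the same
runner. -/
theorem isLargestCore_kappa {s t : ℕ} (hs : 2 ≤ s) (ht : 2 ≤ t) (hst : s.Coprime t) :
    IsLargestCore s t (kappa s t) := by
  have : NeZero s := ⟨by omega⟩
  refine ⟨⟨kappa_mem_cores (by omega) (by omega) hst, ?_⟩, ?_⟩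
  · rw [kappa_comm]
    exact kappa_mem_cores (by omega) (by omega) hst.symm
  rintro mu ⟨hmus, hmut⟩ hne
  obtain ⟨m, c, hm, hp⟩ := exists_isRunner_kappa (s := s) (t := t) (by omega) hst
  obtain ⟨m', hm'⟩ := exists_isRunner ((mem_cores_iff (by omega)).1 hmus)
  have hcond : ∀ c : ZMod s, m' (c + t) ≤ m' c + t := by
    have := hm'.sub_mem_iff.1 ((mem_cores_iff (by omega)).1 hmut)
    simpa using this
  have h1 := hm.two_mul_sum
  have h2 := hm'.two_mul_sum
  have hS : ∑ c, m' c = ∑ c, m c := by linarith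
  have h3 := hp.sum_sq hst
  have h4 := sum_sq_le hst hcond
  have h5 := hm.card_sub_card hm'
  have hs' : (0 : ℤ) < s := by exact_mod_cast NeZero.pos s
  rw [hS] at h4
  have hle : ∑ c, m' c ^ 2 ≤ ∑ c, m c ^ 2 := by
    by_contra hc
    have := mul_lt_mul_of_pos_left (not_le.1 hc) (show (0 : ℤ) < 2 * s by positivity)
    linarith
  have hlt : ∑ c, m' c ^ 2 < ∑ c, m c ^ 2 := by
    refine lt_of_le_of_ne hle fun heq => hne ?_
    obtain ⟨c', hp'⟩ := exists_isProgression hs (by omega) hst hcond (by rw [hS, heq]; linarith)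
    have hmm := hp.ext hst hp' (by linarith) (by linarith) hm.cast_eq hm'.cast_eq
    refine (beta_inj (r := 0) (r' := 0) ?_).2
    ext n
    rw [hm.mem_iff, hm'.mem_iff, hmm]
  have : (0 : ℤ) < 2 * s * ((kappa s t).card - mu.card) := by rw [h5]; linarith
  have := pos_of_mul_pos_right this (by positivity)
  omega

/-! ### The orbit of `kappa s t` -/

/-- Modulo `s` the term `a * s` vanishes, the shifts by `circ s t` cancel and `t` is invertible, so
the case distinction is on the class of `k`. -/
theorem genFun_coordinates {s t : ℕ} (hst : s.Coprime t) (i : ZMod s) (a k : ℤ) :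
    genFun s t i (a * s + k * t - circ s t) = a * s + genFun s 1 i k * t - circ s t := by
  have hcancel : ∀ b : ZMod s,
      ((a * s + k * t - circ s t : ℤ) : ZMod s) = b * t - (circ s t : ZMod s) ↔
        (k : ZMod s) = b := by
    intro b
    push_cast
    rw [CharP.cast_eq_zero, mul_zero, zero_add, sub_left_inj]
    exact ⟨natCast_cancel hst, fun h => by rw [h]⟩
  rw [genFun_one]
  unfold genFun
  simp only [hcancel]
  split_ifs <;> ring

/-- In the coordinates `(a, k)` of `a * s + k * t - circ s t`, the level `t` action of `W s` is the
level one action on the second coordinate. -/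
theorem intAction_coordinates {s t : ℕ} (hs : 2 ≤ s) (hst : s.Coprime t) (w : W s) (a k : ℤ) :
    intAction hs hst w (a * s + k * t - circ s t)
      = a * s + intAction hs s.coprime_one_right w k * t - circ s t := by
  induction w using (affineMatrix s).toCoxeterSystem.simple_induction generalizing k with
  | one => simp
  | mul w w' h h' => simp only [map_mul, Equiv.Perm.mul_apply, h', h]
  | simple i =>
    rw [CoxeterMatrix.toCoxeterSystem_simple, intAction_simple, intAction_simple]
    exact genFun_coordinates hst i a k

theorem mem_beta_action_iff {s t : ℕ} (hs : 2 ≤ s) (hst : s.Coprime t) (w : W s)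
    (lam : YoungDiagram) (n : ℤ) :
    n ∈ beta 0 (action hs hst w lam) ↔ intAction hs hst w⁻¹ n ∈ beta 0 lam := by
  rw [beta_action, map_inv]
  exact Set.mem_image_equiv

theorem mem_beta_orbit {s t : ℕ} (hs : 2 ≤ s) (ht : 2 ≤ t) (hst : s.Coprime t) (w : W s) (x : W t)
    (a k : ℤ) :
    a * s + k * t - circ s t ∈ beta 0 (action hs hst w (action ht hst.symm x (kappa s t))) ↔
      intAction ht t.coprime_one_right x⁻¹ a / t + intAction hs s.coprime_one_right w⁻¹ k / s
        < 0 := by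
  rw [mem_beta_action_iff, mem_beta_action_iff, intAction_coordinates, circ_comm s t,
    add_comm (a * (s : ℤ)), intAction_coordinates, circ_comm t s, add_comm (_ * (t : ℤ)),
    mem_beta_kappa (by omega) (by omega) hst]

/-- The level one action commutes with translation by `q * s`, and the empty partition has the
negative integers as beta-set. Thus `w` enters the criterion of `mem_beta_orbit` only through the
core `w ⊥`. -/
theorem ediv_add_neg_iff {s : ℕ} (hs : 2 ≤ s) (w : W s) (q k : ℤ) :
    q + intAction hs s.coprime_one_right w⁻¹ k / s < 0 ↔
      k + q * s ∈ beta 0 (action hs s.coprime_one_right w ⊥) := by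
  have hs' : (0 : ℤ) < s := by omega
  rw [mem_beta_action_iff, beta_bot, mem_Iio, intAction_add_mul, add_comm q,
    ← Int.add_mul_ediv_right _ _ hs'.ne', Int.ediv_lt_iff_lt_mul hs', zero_mul]

theorem quo_orbit {s t : ℕ} (hs : 2 ≤ s) (ht : 2 ≤ t) (hst : s.Coprime t) (w : W s) (x : W t) :
    quo t 0 (action hs hst w (action ht hst.symm x (kappa s t)))
      = action hs s.coprime_one_right w ⊥ := by
  -- With this choice `t * b` has coordinates `(a, b + k)`: along the class of `0` modulo `t` the
  -- first is constant, so the component's beta-set is a translate of that of `w ⊥`.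
  obtain ⟨a, k, hak⟩ := exists_eq_add_mul hst (circ s t)
  have : {b : ℤ | ((0 : ZMod t).val : ℤ) + (t : ℤ) * b
      ∈ beta 0 (action hs hst w (action ht hst.symm x (kappa s t)))}
      = beta (-(k + intAction ht t.coprime_one_right x⁻¹ a / t * s))
        (action hs s.coprime_one_right w ⊥) := by
    ext b
    rw [mem_ofPred_eq, ZMod.val_zero, show ((0 : ℕ) : ℤ) + (t : ℤ) * b
      = a * s + (b + k) * t - circ s t by rw [hak]; push_cast; ring, mem_beta_orbit,
      ediv_add_neg_iff, mem_beta_iff (r := -_), sub_neg_eq_add, add_assoc]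
  rw [quo, this, ofBeta_beta]

theorem quo_orbit_symm {s t : ℕ} (hs : 2 ≤ s) (ht : 2 ≤ t) (hst : s.Coprime t) (w : W s)
    (x : W t) :
    quo s 0 (action hs hst w (action ht hst.symm x (kappa s t)))
      = action ht t.coprime_one_right x ⊥ := by
  have h := quo_orbit ht hs hst.symm x w
  rw [kappa_comm] at h
  rw [← h]
  congr 1
  exact Equiv.congr_fun (action_commute hs ht hst w x).eq (kappa s t)

/-- In the floor criterion `w` can be exchanged for `w'` with `a` fixed, and then `x` for `x'` with
`k` fixed. -/
theorem orbit_ext {s t : ℕ} (hs : 2 ≤ s) (ht : 2 ≤ t) (hst : s.Coprime t) {w w' : W s}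
    {x x' : W t}
    (hw : action hs s.coprime_one_right w ⊥ = action hs s.coprime_one_right w' ⊥)
    (hx : action ht t.coprime_one_right x ⊥ = action ht t.coprime_one_right x' ⊥) :
    action hs hst w (action ht hst.symm x (kappa s t))
      = action hs hst w' (action ht hst.symm x' (kappa s t)) := by
  refine (beta_inj (r := 0) (r' := 0) (Set.ext fun n => ?_)).2
  obtain ⟨a, k, hak⟩ := exists_eq_add_mul hst (n + circ s t)
  obtain rfl : n = a * s + k * t - circ s t := by linarith
  rw [mem_beta_orbit, mem_beta_orbit, ediv_add_neg_iff, hw, ← ediv_add_neg_iff, add_comm,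
    ediv_add_neg_iff, hx, ← ediv_add_neg_iff, add_comm]

theorem prodAction_apply {s t : ℕ} (hs : 2 ≤ s) (ht : 2 ≤ t) (hst : s.Coprime t) (w : W s)
    (x : W t) (lam : YoungDiagram) :
    prodAction hs ht hst (w, x) lam = action hs hst w (action ht hst.symm x lam) := rfl

theorem exists_of_mem_kappaOrbit {s t : ℕ} {hs : 2 ≤ s} {ht : 2 ≤ t} {hst : s.Coprime t}
    {lam : YoungDiagram} (h : lam ∈ kappaOrbit hs ht hst) :
    ∃ (w : W s) (x : W t), action hs hst w (action ht hst.symm x (kappa s t)) = lam := by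
  obtain ⟨⟨w, x⟩, h⟩ := h
  exact ⟨w, x, h⟩

theorem action_orbit {s t : ℕ} (hs : 2 ≤ s) (ht : 2 ≤ t) (hst : s.Coprime t) (w v : W s)
    (x y : W t) :
    action hs hst v (action ht hst.symm y (action hs hst w (action ht hst.symm x (kappa s t))))
      = action hs hst (v * w) (action ht hst.symm (y * x) (kappa s t)) := by
  have h := Equiv.congr_fun (action_commute hs ht hst w y).eq (action ht hst.symm x (kappa s t))
  simp only [Equiv.Perm.mul_apply] at h
  simp only [map_mul, Equiv.Perm.mul_apply, h]

theorem quo_prodAction {s t : ℕ} {hs : 2 ≤ s} {ht : 2 ≤ t} {hst : s.Coprime t}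
    {lam : YoungDiagram} (h : lam ∈ kappaOrbit hs ht hst) (v : W s) (y : W t) :
    quo t 0 (action hs hst v (action ht hst.symm y lam))
        = action hs s.coprime_one_right v (quo t 0 lam) ∧
      quo s 0 (action hs hst v (action ht hst.symm y lam))
        = action ht t.coprime_one_right y (quo s 0 lam) := by
  obtain ⟨w, x, rfl⟩ := exists_of_mem_kappaOrbit h
  rw [action_orbit, quo_orbit, quo_orbit, quo_orbit_symm, quo_orbit_symm, map_mul, map_mul]
  exact ⟨rfl, rfl⟩

theorem bijOn_quo {s t : ℕ} (hs : 2 ≤ s) (ht : 2 ≤ t) (hst : s.Coprime t) :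
    Set.BijOn (fun lam => (quo t 0 lam, quo s 0 lam)) (kappaOrbit hs ht hst)
      (cores s ×ˢ cores t) := by
  refine ⟨fun lam h => ?_, fun lam h lam' h' heq => ?_, ?_⟩
  · obtain ⟨w, x, rfl⟩ := exists_of_mem_kappaOrbit h
    exact ⟨(mem_cores_iff_exists_action hs).2 ⟨w, (quo_orbit hs ht hst w x).symm⟩,
      (mem_cores_iff_exists_action ht).2 ⟨x, (quo_orbit_symm hs ht hst w x).symm⟩⟩
  · obtain ⟨w, x, rfl⟩ := exists_of_mem_kappaOrbit h
    obtain ⟨w', x', rfl⟩ := exists_of_mem_kappaOrbit h'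
    simp only [quo_orbit, quo_orbit_symm, Prod.mk.injEq] at heq
    exact orbit_ext hs ht hst heq.1 heq.2
  · rintro ⟨mu, nu⟩ ⟨hmu, hnu⟩
    obtain ⟨w, hw⟩ := (mem_cores_iff_exists_action hs).1 hmu
    obtain ⟨x, hx⟩ := (mem_cores_iff_exists_action ht).1 hnu
    refine ⟨prodAction hs ht hst (w, x) (kappa s t), ⟨(w, x), rfl⟩, ?_⟩
    simp only [prodAction_apply, quo_orbit, quo_orbit_symm, hw, hx]

end KappaOrbit

theorem mainTheorem8 (s t : ℕ) (hs : 2 ≤ s) (ht : 2 ≤ t) (hst : s.Coprime t) :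
    -- `kappa s t` is the unique largest `(s, t)`-core
    IsLargestCore s t (kappa s t) ∧
    -- the bijection between the orbit and pairs consisting of an `s`-core and a `t`-core
    Set.BijOn (fun lam => (quo t 0 lam, quo s 0 lam)) (kappaOrbit hs ht hst)
      (cores s ×ˢ cores t) ∧
    -- it intertwines the level `t` action of `W_s` with the level `1` action on `s`-cores
    (∀ lam ∈ kappaOrbit hs ht hst, ∀ w : W s,
      quo t 0 (action hs hst w lam) = action hs s.coprime_one_right w (quo t 0 lam)) ∧
    -- it intertwines the level `s` action of `W_t` with the level `1` action on `t`-cores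
    (∀ lam ∈ kappaOrbit hs ht hst, ∀ x : W t,
      quo s 0 (action ht hst.symm x lam) = action ht t.coprime_one_right x (quo s 0 lam)) ∧
    -- it is an isomorphism of `W_s × W_t`-sets
    (∀ lam ∈ kappaOrbit hs ht hst, ∀ (w : W s) (x : W t),
      quo t 0 (prodAction hs ht hst (w, x) lam) = action hs s.coprime_one_right w (quo t 0 lam) ∧
      quo s 0 (prodAction hs ht hst (w, x) lam) = action ht t.coprime_one_right x (quo s 0 lam)) := by
  refine ⟨isLargestCore_kappa hs ht hst, bijOn_quo hs ht hst, fun lam h w => ?_,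
    fun lam h x => ?_, fun lam h w x => quo_prodAction h w x⟩
  · simpa using (quo_prodAction h w 1).1
  · simpa using (quo_prodAction h 1 x).2
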